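/- Let $A$ be a finite set, let $A^*$ be the free monoid on $A$, and let $R\subseteq A^*\times A^*$ be a finite set of rules. Write $w_1lw_2\to w_1rw_2$ for $(l,r)\in R$ and $w_1,w_2\in A^*$, and let $\to^*$ be the reflexive and transitive closure of $\to$. Suppose that the rewriting system $R$ is complete, that is, noetherian (there is no infinite chain $u_0\to u_1\to u_2\to\cdots$) and confluent (if $u\to^*v$ and $u\to^*v'$, then $v\to^*w$ and $v'\to^*w$ for some $w\in A^*$). Let $M$ be a monoid isomorphic to the quotient of $A^*$ by the smallest congruence containing $R$. Then $M$ is of type left-${\rm F}_\infty$, right-${\rm F}_\infty$ and bi-${\rm F}_\infty$. Moreover, $M$ is of type bi-${\rm FP}_\infty$, left-${\rm FP}_\infty$ and right-${\rm FP}_\infty$. Here the terms have the following meaning. For a monoid $N$, an $N$-set $P$ is projective if every $N$-equivariant surjection onto $P$ has an $N$-equivariant section. A projective $N$-CW complex is a space $X$ with a continuous action of the discrete monoid $N$ that is the direct limit of $N$-invariant subspaces $\emptyset=X_{-1}\subseteq X_0\subseteq X_1\subseteq\cdots$, where $X_n$ is obtained from $X_{n-1}$ as a pushout of $P_n\times B^n\hookleftarrow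 P_n\times S^{n-1}\to X_{n-1}$ along an $N$-equivariant attaching map, with $P_n$ a discrete projective $N$-set and $N$ acting trivially on the closed unit ball $B^n\subseteq\mathbb R^n$. It is of $N$-finite type if every $P_n$ is a finitely generated $N$-set. * $M$ is of type left-${\rm F}_\infty$ if there is a contractible projective $M$-CW complex of $M$-finite type, and of type right-${\rm F}_\infty$ if the opposite monoid $M^{op}$ is of type left-${\rm F}_\infty$. * $M$ is of type bi-${\rm F}_\infty$ if there is a projective $M\times M^{op}$-CW complex $X$ of $M\times M^{op}$-finite type such that every component of $X$ is contractible and $\pi_0(X)\cong M$ as $M\times M^{op}$-sets, where $(a,b)$ acts on $M$ by $m\mapsto amb$. * $M$ is of type left-${\rm FP}_\infty$ if the trivial left $\mathbb ZM$-module $\mathbb Z$ has a resolution by finitely generated projective left $\mathbb ZM$-modules, of type right-${\rm FP}_\infty$ if $M^{op}$ is of type left-${\rm FP}_\infty$, and of type bi-${\rm FP}_\infty$ if the $(\mathbb ZM,\mathbb ZM)$-bimodule $\mathbb ZM$ has a resolution by finitely generated projective $(\mathbb ZM,\mathbb ZM)$-bimodules. -/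

import Mathlib

universe u v w

/-! ### String rewriting systems -/

namespace StringRewriting

/-- Single-step reduction `w₁ l w₂ → w₁ r w₂`, for a rule `(l, r) ∈ R` and words `w₁`, `w₂`. -/
def Step {A : Type v} (R : Set (FreeMonoid A × FreeMonoid A)) (x y : FreeMonoid A) : Prop :=
  ∃ l r w₁ w₂ : FreeMonoid A, (l, r) ∈ R ∧ x = w₁ * l * w₂ ∧ y = w₁ * r * w₂

/-- The reflexive and transitive closure of single-step reduction. -/
def Reduces {A : Type v} (R : Set (FreeMonoid A × FreeMonoid A)) :
    FreeMonoid A → FreeMonoid A → Prop :=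
  Relation.ReflTransGen (Step R)

/-- There is no infinite chain of single-step reductions. -/
def Noetherian {A : Type v} (R : Set (FreeMonoid A × FreeMonoid A)) : Prop :=
  ¬ ∃ f : ℕ → FreeMonoid A, ∀ n, Step R (f n) (f (n + 1))

/-- Two words obtained from a common word can be reduced to a common word. -/
def Confluent {A : Type v} (R : Set (FreeMonoid A × FreeMonoid A)) : Prop :=
  ∀ x y z : FreeMonoid A, Reduces R x y → Reduces R x z →
    ∃ t : FreeMonoid A, Reduces R y t ∧ Reduces R z t

/-- A rewriting system is complete if it is noetherian and confluent. -/
def Complete {A : Type v} (R : Set (FreeMonoid A × FreeMonoid A)) : Prop :=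
  Noetherian R ∧ Confluent R

/-- `⟨A | R⟩` is a presentation of the monoid `M`: `M` is isomorphic to the quotient of the free
monoid on `A` by the smallest congruence that contains `R`. -/
def Presents {A : Type v} (R : Set (FreeMonoid A × FreeMonoid A)) (M : Type u) [Monoid M] : Prop :=
  Nonempty (PresentedMonoid (fun x y : FreeMonoid A => (x, y) ∈ R) ≃* M)

end StringRewriting

/-! ### `M`-sets, projective `M`-CW complexes and the topological finiteness properties -/

namespace MonoidTopology

/-- An `M`-set is projective if every equivariant surjection onto it has an equivariant section. -/
def ProjectiveMSet (M : Type u) [Monoid M] (P : Type w) [MulAction M P] : Prop :=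
  ∀ (Q : Type (max u w)) [MulAction M Q] (f : Q →[M] P), Function.Surjective f →
    ∃ s : P →[M] Q, ∀ p, f (s p) = p

/-- An `M`-set is finitely generated if it is the union of finitely many orbits `M s`. -/
def FGMSet (M : Type u) [Monoid M] (P : Type w) [MulAction M P] : Prop :=
  ∃ S : Finset P, ∀ p : P, ∃ s ∈ S, ∃ m : M, p = m • s

/-- The closed unit ball `Bⁿ` in Euclidean `n`-space. -/
abbrev Ball (n : ℕ) : Type := Metric.closedBall (0 : EuclideanSpace ℝ (Fin n)) 1

/-- The structure of a projective `M`-CW complex on an `M`-space `X`.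

The set `skelLT n` is the `(n - 1)`-skeleton, so `skelLT 0 = ∅`. The `n`-skeleton
`skelLT (n + 1)` is the pushout of the `(n - 1)`-skeleton and `cell n × Bⁿ` along an equivariant
attaching map `cell n × Sⁿ⁻¹ → skelLT n`, where `cell n` is a projective `M`-set with the discrete
topology and `M` acts trivially on `Bⁿ`; and `X` is the direct limit of its skeleta. -/
structure ProjectiveCW (M : Type u) [Monoid M] (X : Type w) [TopologicalSpace X]
    [MulAction M X] where
  /-- The projective `M`-set that indexes the `n`-cells. -/
  cell : ℕ → Type w
  /-- The action of `M` on the set of `n`-cells. -/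
  cellAction : ∀ n, MulAction M (cell n)
  projective : ∀ n, ProjectiveMSet M (cell n)
  /-- The skeleton of dimension `n - 1`. -/
  skelLT : ℕ → Set X
  skelLT_zero : skelLT 0 = ∅
  /-- The characteristic maps. -/
  charMap : ∀ n, cell n → C(Ball n, X)
  /-- The characteristic map `cell n × Bⁿ → X` is equivariant. -/
  charMap_smul : ∀ (n : ℕ) (m : M) (e : cell n) (b : Ball n),
    charMap n (m • e) b = m • charMap n e b
  /-- The sphere `Sⁿ⁻¹` is mapped to the `(n - 1)`-skeleton. -/
  charMap_sphere : ∀ (n : ℕ) (e : cell n) (b : Ball n), ‖(b : EuclideanSpace ℝ (Fin n))‖ = 1 →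
    charMap n e b ∈ skelLT n
  /-- The underlying set of the `n`-skeleton is the disjoint union of the `(n - 1)`-skeleton and
  the product of `cell n` with the open ball (see also the next two fields). -/
  skelLT_succ : ∀ n, skelLT (n + 1) = skelLT n ∪ {x | ∃ e b, charMap n e b = x}
  charMap_notMem : ∀ (n : ℕ) (e : cell n) (b : Ball n), ‖(b : EuclideanSpace ℝ (Fin n))‖ < 1 →
    charMap n e b ∉ skelLT n
  charMap_inj : ∀ (n : ℕ) (e e' : cell n) (b b' : Ball n),
    ‖(b : EuclideanSpace ℝ (Fin n))‖ < 1 → ‖(b' : EuclideanSpace ℝ (Fin n))‖ < 1 →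
    charMap n e b = charMap n e' b' → e = e' ∧ b = b'
  /-- The `n`-skeleton has the topology of the pushout (and is closed in `X`). -/
  isClosed_of_skelLT_succ : ∀ (n : ℕ) (T : Set X), T ⊆ skelLT (n + 1) →
    IsClosed (T ∩ skelLT n) → (∀ e, IsClosed (charMap n e ⁻¹' T)) → IsClosed T
  /-- The space `X` is the union of its skeleta. -/
  iUnion_skelLT : ⋃ n, skelLT n = Set.univ
  /-- The space `X` has the direct limit topology. -/
  isClosed_of_skelLT : ∀ T : Set X, (∀ n, IsClosed (T ∩ skelLT n)) → IsClosed T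

attribute [instance] ProjectiveCW.cellAction

/-- A projective `M`-CW complex is of `M`-finite type if, for each `n`, the `M`-set of `n`-cells is
finitely generated. -/
def ProjectiveCW.FiniteType {M : Type u} [Monoid M] {X : Type w} [TopologicalSpace X]
    [MulAction M X] (K : ProjectiveCW M X) : Prop :=
  ∀ n, FGMSet M (K.cell n)

/-- The monoid `M` is of type left-`F_∞`: it has an equivariant classifying space, that is, a
contractible projective `M`-CW complex, that is of `M`-finite type. -/
def LeftFInfty (M : Type u) [Monoid M] : Prop :=
  ∃ (X : Type u) (_ : TopologicalSpace X) (_ : MulAction M X) (_ : ContinuousConstSMul M X)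
    (K : ProjectiveCW M X), ContractibleSpace X ∧ K.FiniteType

/-- The monoid `M` is of type right-`F_∞` if `Mᵐᵒᵖ` is of type left-`F_∞`. -/
def RightFInfty (M : Type u) [Monoid M] : Prop := LeftFInfty Mᵐᵒᵖ

/-- The action of `M` on the set `π₀(X)` of path components of an `M`-space. -/
instance zerothHomotopyAction (M : Type u) [Monoid M] (X : Type w) [TopologicalSpace X]
    [MulAction M X] [ContinuousConstSMul M X] : MulAction M (ZerothHomotopy X) where
  smul m := Quotient.map (fun x : X => m • x)
    (fun _ _ h => h.map (f := fun x : X => m • x) (continuous_const_smul m))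
  one_smul := by
    rintro ⟨x⟩
    exact congrArg ZerothHomotopy.mk (one_smul M x)
  mul_smul := by
    rintro a b ⟨x⟩
    exact congrArg ZerothHomotopy.mk (mul_smul a b x)

/-- The action `(a, b) • m = a m b` of `M × Mᵐᵒᵖ` on `M`. -/
@[reducible]
def biAction (M : Type u) [Monoid M] : MulAction (M × Mᵐᵒᵖ) M where
  smul p m := p.1 * m * p.2.unop
  one_smul m := show 1 * m * 1 = m by simp
  mul_smul p q m := show (p.1 * q.1) * m * (q.2.unop * p.2.unop) =
    p.1 * (q.1 * m * q.2.unop) * p.2.unop by simp only [mul_assoc]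

/-- The monoid `M` is of type bi-`F_∞`: it has a bi-equivariant classifying space of
`M × Mᵐᵒᵖ`-finite type. A bi-equivariant classifying space is a projective `M × Mᵐᵒᵖ`-CW complex
`X` with contractible components such that `π₀(X)` and `M` are isomorphic `M × Mᵐᵒᵖ`-sets. -/
def BiFInfty (M : Type u) [Monoid M] : Prop :=
  letI : MulAction (M × Mᵐᵒᵖ) M := biAction M
  ∃ (X : Type u) (_ : TopologicalSpace X) (_ : MulAction (M × Mᵐᵒᵖ) X)
    (_ : ContinuousConstSMul (M × Mᵐᵒᵖ) X) (K : ProjectiveCW (M × Mᵐᵒᵖ) X),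
    (∃ f : ZerothHomotopy X ≃ M, ∀ (p : M × Mᵐᵒᵖ) (c : ZerothHomotopy X), f (p • c) = p • f c) ∧
    (∀ x : X, ContractibleSpace (pathComponent x)) ∧ K.FiniteType

/-! ### Homological finiteness properties -/

/-- The module `V` over the ring `R` has a resolution
`⋯ → P 2 → P 1 → P 0 → V → 0` by finitely generated projective modules. -/
def FPInftyModule (R : Type u) [Ring R] (V : Type w) [AddCommGroup V] [Module R V] : Prop :=
  ∃ (P : ℕ → Type u) (_ : ∀ n, AddCommGroup (P n)) (_ : ∀ n, Module R (P n))
    (d : ∀ n, P (n + 1) →ₗ[R] P n) (ε : P 0 →ₗ[R] V),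
    (∀ n, Module.Projective R (P n) ∧ Module.Finite R (P n)) ∧
    (∀ n, Function.Exact (d (n + 1)) (d n)) ∧ Function.Exact (d 0) ε ∧ Function.Surjective ε

/-- The monoid `M` is of type left-`FP_∞`: the trivial left `ℤM`-module `ℤ` has a resolution by
finitely generated projective modules. -/
def LeftFPInfty (M : Type u) [Monoid M] : Prop :=
  FPInftyModule (MonoidAlgebra ℤ M) (Representation.trivial ℤ M ℤ).asModule

/-- The monoid `M` is of type right-`FP_∞` if `Mᵐᵒᵖ` is of type left-`FP_∞` (right `ℤM`-modules are
left modules over the monoid ring of `Mᵐᵒᵖ`). -/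
def RightFPInfty (M : Type u) [Monoid M] : Prop := LeftFPInfty Mᵐᵒᵖ

/-- The monoid `M` is of type bi-`FP_∞`: the `(ℤM, ℤM)`-bimodule `ℤM` has a resolution by finitely
generated projective bimodules. Here `(ℤM, ℤM)`-bimodules are left modules over the monoid ring of
`M × Mᵐᵒᵖ`, and `(a, b)` sends a basis element `m` of `ℤM` to `a m b`. -/
def BiFPInfty (M : Type u) [Monoid M] : Prop :=
  letI : MulAction (M × Mᵐᵒᵖ) M := biAction M
  FPInftyModule (MonoidAlgebra ℤ (M × Mᵐᵒᵖ)) (Representation.ofMulAction ℤ (M × Mᵐᵒᵖ) M).asModule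

end MonoidTopology

/-!
# Monoids with finite complete presentations are of type `F_∞` and `FP_∞`

A complete rewriting system gives every element of the monoid `M` a unique normal form, and gives
the normal forms a geometry: a free complex with cells `M × V n × M`, where `V n` is the set of
Anick chains with `n` entries. A chain starts with a letter and is grown to the left, each time by
the shortest word that makes a reducible product with the previous entry. Such words are at most one
letter longer than the longest left-hand side of a rule, so `V n` is finite (`finite_chains`).

What is used of the chains is a recipe for collapsing the complex, `CollapsingScheme`, which
`NormalForms.collapsingScheme` provides. In each dimension, the cells that are not collapsible (or
critical, in dimension `0`) are matched with the collapsible cells of the next dimension, as free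
faces, and the matching is acyclic: sweeping a redundant cell across its partner leads to cells
whose word has been reduced further, or whose chain has moved to the left inside the same word
(`cellLT_of_red`). The first can happen only finitely often because the system is noetherian, the
second because there is no more room. The critical cells are the vertices `(1, *, t)`, one for each
`t : M`.

A remarkable feature is that the boundary maps need not be known beforehand. Given the boundary in
degrees up to `n` and the contraction in lower degrees, the boundary of the chain `u :: c` is `u c`
minus the contraction of the boundary of `u c`, and then well-founded recursion gives the
contraction in degree `n`. The result is a complex with a contracting homotopy, `D H + H D = 1`
(`D_H`).

The same recursion works for spaces. The cell of `u :: c` is a cube; the bottom face is attached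
along the cell of `c`, translated by `u`, the top face is mapped to the critical vertex of its
component, and on the sides the first coordinate is the time of the contraction of the boundary of
the bottom face. The contraction follows a flow that pushes the bottom face of a collapsible cube to
the other faces, and then goes on from the exit point (`sweep`). All properties, the continuity
among them, are proved by induction over the order in which the redundant cells are collapsed
(`good`, `att_and_hCont`). By the exponential law, a homotopy is continuous as soon as it is
continuous on closed cells (`Att.continuous_homotopy`).

The contractions commute with the right action of `M`, so they survive when the last component of
the cells is changed from `M` to a left `M`-set `T`. With `T = M`, the result is the bi-equivariant
classifying space and the bimodule resolution; with `T` a point, it is the left equivariant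
classifying space and the resolution of `ℤ`. Both are treated together by a `Frame`, which describes
the monoid that acts freely on `M × T`. The statements for right actions follow by reversing all
words (`NormalForms.op`).
-/

/-! ### Normal forms of a complete rewriting system -/

namespace StringRewriting

/-- What a finite complete presentation of `M` over the alphabet `A` provides: evaluation `ev` of
words in `M`, the normal form `nf m` of an element, and the reduction preorder `red` on words.
A word `w` is irreducible when it is a normal form, that is, `nf (ev w) = w`; the field `bound` says
that the minimal reducible words have bounded length. -/
structure NormalForms (M : Type u) [Monoid M] (A : Type v) where
  nf : M → List A
  ev : List A → M
  red : List A → List A → Prop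
  ev_nil : ev [] = 1
  ev_append : ∀ x y, ev (x ++ y) = ev x * ev y
  ev_nf : ∀ m, ev (nf m) = m
  red_refl : ∀ x, red x x
  red_trans : ∀ {x y z}, red x y → red y z → red x z
  red_append : ∀ (p q : List A) {x y}, red x y → red (p ++ x ++ q) (p ++ y ++ q)
  red_nf : ∀ x, red x (nf (ev x))
  red_ev : ∀ {x y}, red x y → ev x = ev y
  wf : WellFounded fun y x : List A => red x y ∧ x ≠ y
  bound : ∃ L : ℕ, ∀ w, nf (ev w) ≠ w →
    ∃ p l q, w = p ++ l ++ q ∧ l.length ≤ L ∧ nf (ev l) ≠ l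

section Construction

variable {A : Type v} {R : Set (FreeMonoid A × FreeMonoid A)}

theorem Step.mul {x y : FreeMonoid A} (h : Step R x y) (p q : FreeMonoid A) :
    Step R (p * x * q) (p * y * q) := by
  obtain ⟨l, r, w₁, w₂, hR, rfl, rfl⟩ := h
  exact ⟨l, r, p * w₁, w₂ * q, hR, by simp only [mul_assoc], by simp only [mul_assoc]⟩

theorem Reduces.mul {x y : FreeMonoid A} (h : Reduces R x y) (p q : FreeMonoid A) :
    Reduces R (p * x * q) (p * y * q) := by
  induction h with
  | refl => exact .refl
  | tail _ hs ih => exact ih.tail (hs.mul p q)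

/-- In a confluent system, congruent words reduce to a common word. -/
theorem Confluent.exists_reduces_of_rel (hc : Confluent R) {x y : FreeMonoid A}
    (h : ConGen.Rel (fun x y : FreeMonoid A => (x, y) ∈ R) x y) :
    ∃ t, Reduces R x t ∧ Reduces R y t := by
  induction h with
  | of x y h => exact ⟨y, .single ⟨x, y, 1, 1, h, by simp, by simp⟩, .refl⟩
  | refl x => exact ⟨x, .refl, .refl⟩
  | symm _ ih => exact ih.imp fun _ h => h.symm
  | trans _ _ ih₁ ih₂ =>
    obtain ⟨s, h₁, h₂⟩ := ih₁
    obtain ⟨t, h₃, h₄⟩ := ih₂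
    obtain ⟨r, h₅, h₆⟩ := hc _ _ _ h₂ h₃
    exact ⟨r, h₁.trans h₅, h₄.trans h₆⟩
  | @mul w x y z _ _ ih₁ ih₂ =>
    obtain ⟨s, h₁, h₂⟩ := ih₁
    obtain ⟨t, h₃, h₄⟩ := ih₂
    refine ⟨s * t, ?_, ?_⟩
    · have a := h₁.mul 1 y
      have b := h₃.mul s 1
      simp only [one_mul, mul_one] at a b
      exact a.trans b
    · have a := h₂.mul 1 z
      have b := h₄.mul s 1
      simp only [one_mul, mul_one] at a b
      exact a.trans b

theorem Noetherian.wellFounded (hn : Noetherian R) :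
    WellFounded fun y x => Step R x y := by
  rw [wellFounded_iff_isEmpty_descending_chain]
  exact ⟨fun f => hn ⟨f.1, f.2⟩⟩

theorem Noetherian.exists_irreducible (hn : Noetherian R) (x : FreeMonoid A) :
    ∃ y, Reduces R x y ∧ ∀ z, ¬ Step R y z := by
  induction x using hn.wellFounded.induction with
  | _ x ih =>
    by_cases h : ∃ z, Step R x z
    · obtain ⟨z, hz⟩ := h
      obtain ⟨y, hy, hy'⟩ := ih z hz
      exact ⟨y, .head hz hy, hy'⟩
    · exact ⟨x, .refl, fun z hz => h ⟨z, hz⟩⟩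

theorem eq_of_reduces_of_irreducible {x y : FreeMonoid A} (hx : ∀ z, ¬ Step R x z)
    (h : Reduces R x y) : x = y := by
  rcases Relation.ReflTransGen.cases_head h with h | ⟨z, hz, -⟩
  · exact h
  · exact (hx z hz).elim

/-- A complete presentation has unique normal forms, and for a finite one the length of the minimal
reducible words is bounded by the length of the left-hand sides of the rules. -/
theorem Complete.nonempty_normalForms {M : Type u} [Monoid M] (hfin : R.Finite)
    (hc : Complete R) (hp : Presents R M) : Nonempty (NormalForms M A) := by
  obtain ⟨e⟩ := hp
  let rels := fun x y : FreeMonoid A => (x, y) ∈ R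
  let π : FreeMonoid A →* M := e.toMonoidHom.comp (PresentedMonoid.mk rels)
  have hπ : ∀ x y, π x = π y → ∃ t, Reduces R x t ∧ Reduces R y t := fun x y h =>
    hc.2.exists_reduces_of_rel ((conGen rels).eq.1 (e.injective h))
  have hπ' : ∀ x y, Reduces R x y → π x = π y := by
    intro x y h
    induction h with
    | refl => rfl
    | tail _ hs ih =>
      obtain ⟨l, r, w₁, w₂, hR, rfl, rfl⟩ := hs
      rw [ih, map_mul, map_mul, map_mul, map_mul]
      congr 2
      exact congrArg e ((conGen rels).eq.2 (ConGen.Rel.of l r hR))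
  have hsurj : ∀ m, ∃ x, π x = m ∧ ∀ z, ¬ Step R x z := by
    intro m
    obtain ⟨x, hx⟩ := Con.mk'_surjective (c := conGen rels) (e.symm m)
    obtain ⟨y, hy, hy'⟩ := hc.1.exists_irreducible x
    refine ⟨y, ?_, hy'⟩
    rw [← hπ' x y hy]
    change e (PresentedMonoid.mk rels x) = m
    exact (congrArg e hx).trans (e.apply_symm_apply m)
  choose nf hnf hirr using hsurj
  have hred : ∀ x, Reduces R x (nf (π x)) := by
    intro x
    obtain ⟨t, h₁, h₂⟩ := hπ x (nf (π x)) (hnf (π x)).symm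
    rwa [eq_of_reduces_of_irreducible (hirr _) h₂]
  refine ⟨{ nf := fun m => (nf m).toList
            ev := fun w => π (FreeMonoid.ofList w)
            red := fun x y => Reduces R (FreeMonoid.ofList x) (FreeMonoid.ofList y)
            ev_nil := map_one π
            ev_append := fun x y => map_mul π (FreeMonoid.ofList x) (FreeMonoid.ofList y)
            ev_nf := hnf
            red_refl := fun _ => .refl
            red_trans := fun h h' => h.trans h'
            red_append := fun p q x y h => h.mul (FreeMonoid.ofList p) (FreeMonoid.ofList q)
            red_nf := fun x => hred (FreeMonoid.ofList x)
            red_ev := hπ' _ _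
            wf := ?_
            bound := ?_ }⟩
  · refine Subrelation.wf ?_ hc.1.wellFounded.transGen
    rintro y x ⟨h, hne⟩
    rcases Relation.reflTransGen_iff_eq_or_transGen.1 h with h | h
    · exact (hne h.symm).elim
    · exact Relation.transGen_swap.1 h
  · obtain ⟨L, hL⟩ := (hfin.image fun p => p.1.length).bddAbove
    refine ⟨L, fun w hw => ?_⟩
    by_cases h : ∃ z, Step R (FreeMonoid.ofList w) z
    · obtain ⟨z, l, r, p, q, hR, h, -⟩ := h
      refine ⟨p.toList, l.toList, q.toList, h, hL ⟨_, hR, rfl⟩, fun hl => ?_⟩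
      exact hirr (π l) r (by
        have : nf (π l) = l := hl
        rw [this]
        exact ⟨l, r, 1, 1, hR, by simp, by simp⟩)
    · exact (hw (eq_of_reduces_of_irreducible (fun z hz => h ⟨z, hz⟩) (hred _)).symm).elim

end Construction

namespace NormalForms

variable {M : Type u} [Monoid M] {A : Type v} (N : NormalForms M A)

/-- Reversing all words turns normal forms for `M` into normal forms for the opposite monoid. -/
def op : NormalForms Mᵐᵒᵖ A where
  nf m := (N.nf m.unop).reverse
  ev w := MulOpposite.op (N.ev w.reverse)
  red x y := N.red x.reverse y.reverse
  ev_nil := by simp [N.ev_nil]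
  ev_append x y := by simp [N.ev_append]
  ev_nf m := by simp [N.ev_nf]
  red_refl _ := N.red_refl _
  red_trans := N.red_trans
  red_append p q x y h := by simpa using N.red_append q.reverse p.reverse h
  red_nf x := by simpa using N.red_nf x.reverse
  red_ev h := by rw [N.red_ev h]
  wf := by
    refine Subrelation.wf ?_ (InvImage.wf List.reverse N.wf)
    rintro y x ⟨h, hne⟩
    exact ⟨h, by simpa using hne⟩
  bound := by
    obtain ⟨L, hL⟩ := N.bound
    refine ⟨L, fun w hw => ?_⟩
    obtain ⟨p, l, q, h, hl, hl'⟩ := hL w.reverse fun h => hw (by simp [h])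
    refine ⟨q.reverse, l.reverse, p.reverse, ?_, by simpa using hl, fun h => hl' ?_⟩
    · rw [← w.reverse_reverse, h]
      simp
    · simpa using congrArg List.reverse h

/-- A word is irreducible if it is a normal form. -/
def Irr (w : List A) : Prop := N.nf (N.ev w) = w

theorem irr_nf (m : M) : N.Irr (N.nf m) := by rw [Irr, N.ev_nf]

theorem nf_injective : Function.Injective N.nf := fun a b h => by
  rw [← N.ev_nf a, h, N.ev_nf]

theorem red_antisymm {x y : List A} (h : N.red x y) (h' : N.red y x) : x = y := by
  by_contra hne
  exact N.wf.asymmetric _ _ ⟨h, hne⟩ ⟨h', Ne.symm hne⟩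

variable {N}

theorem Irr.eq_of_red {x y : List A} (hx : N.Irr x) (h : N.red x y) : y = x := by
  refine N.red_antisymm ?_ h
  have := N.red_nf y
  rwa [← N.red_ev h, hx] at this

theorem Irr.infix {p w q : List A} (h : N.Irr (p ++ w ++ q)) : N.Irr w := by
  have := h.eq_of_red (N.red_append p q (N.red_nf w))
  exact List.append_cancel_left (List.append_cancel_right this)

theorem Irr.left {x y : List A} (h : N.Irr (x ++ y)) : N.Irr x :=
  Irr.infix (p := []) (q := y) (by simpa using h)

theorem Irr.right {x y : List A} (h : N.Irr (x ++ y)) : N.Irr y :=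
  Irr.infix (p := x) (q := []) (by simpa using h)

theorem irr_nil : N.Irr [] := Irr.left (x := []) (y := N.nf 1) (by simpa using N.irr_nf 1)

theorem nf_one : N.nf 1 = [] := by rw [← N.ev_nil]; exact irr_nil

theorem nf_mul {a b : M} (h : N.Irr (N.nf a ++ N.nf b)) : N.nf (a * b) = N.nf a ++ N.nf b := by
  have := h
  rwa [Irr, N.ev_append, N.ev_nf, N.ev_nf] at this

theorem red_nf_mul (a b : M) : N.red (N.nf a ++ N.nf b) (N.nf (a * b)) := by
  have := N.red_nf (N.nf a ++ N.nf b)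
  rwa [N.ev_append, N.ev_nf, N.ev_nf] at this

end NormalForms

end StringRewriting

/-! ### Anick chains and the collapsing scheme of a monoid -/

/-- A combinatorial recipe for collapsing a complex with cells `M × V n × M` in dimension `n`.

A cell `(m, c, m')` with `Col m c` is *collapsible* when its dimension is positive and *critical*
when its dimension is zero; the other cells are *redundant*. By the fields `not_col_tail`,
`exists_lift` and `lift_unique`, the map `(m, d, m') ↦ (m * head d, tail d, m')` is a bijection from
the collapsible `(n + 1)`-cells onto the redundant `n`-cells: a redundant cell is a free face of its
collapsible partner. The preorder `le` bounds the cells that occur in the boundary of a cell and in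
its collapse, and `lt` is the well-founded order in which the redundant cells are collapsed. -/
structure CollapsingScheme (M : Type u) [Monoid M] where
  V : ℕ → Type u
  finite : ∀ n, Finite (V n)
  base : V 0
  eq_base : ∀ c : V 0, c = base
  head : ∀ {n}, V (n + 1) → M
  tail : ∀ {n}, V (n + 1) → V n
  /-- The element of `M` that a chain represents. -/
  val : ∀ {n}, V n → M
  val_base : val base = 1
  val_succ : ∀ {n} (d : V (n + 1)), val d = head d * val (tail d)
  /-- The cells `(m, c, m')` that are collapsible or critical; this does not depend on `m'`. -/
  Col : ∀ {n}, M → V n → Prop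
  col_base : ∀ m, Col m base ↔ m = 1
  not_col_tail : ∀ {n} {m : M} {d : V (n + 1)}, Col m d → ¬ Col (m * head d) (tail d)
  exists_lift : ∀ {n} {m : M} {c : V n}, ¬ Col m c →
    ∃ (m₁ : M) (d : V (n + 1)), Col m₁ d ∧ m₁ * head d = m ∧ tail d = c
  lift_unique : ∀ {n} {m₁ m₂ : M} {d₁ d₂ : V (n + 1)}, Col m₁ d₁ → Col m₂ d₂ →
    m₁ * head d₁ = m₂ * head d₂ → tail d₁ = tail d₂ → m₁ = m₂ ∧ d₁ = d₂
  /-- `le f e`: the cell `f` is bounded by the cell `e`. -/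
  le : ∀ {n k}, M × V n × M → M × V k × M → Prop
  le_refl : ∀ {n} (e : M × V n × M), le e e
  le_trans : ∀ {n k l} {e : M × V n × M} {f : M × V k × M} {g : M × V l × M},
    le e f → le f g → le e g
  le_mul : ∀ {n k} {x y : M} {c : V n} {c' : V k} (m m' : M), le (x, c, y) (1, c', 1) →
    le (m * x, c, y * m') (m, c', m')
  le_tail : ∀ {n} (m m' : M) (d : V (n + 1)), le (m * head d, tail d, m') (m, d, m')
  le_of_col : ∀ {n} {m : M} (m' : M) {d : V (n + 1)}, Col m d →
    le (m, d, m') (m * head d, tail d, m')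
  le_base : ∀ {n} (m m' : M) (c : V n), le (1, base, m * val c * m') (m, c, m')
  val_eq_of_le : ∀ {n k} {e : M × V n × M} {f : M × V k × M}, le e f →
    e.1 * val e.2.1 * e.2.2 = f.1 * val f.2.1 * f.2.2
  lt : ∀ {n}, M × V n × M → M × V n × M → Prop
  lt_wf : ∀ n, WellFounded (lt (n := n))
  /-- If a collapsible or critical cell `(x, c, y)` is bounded by `(1, d, 1)`, then its translate
  precedes the free face of `(m, d, m')`. -/
  lt_of_le : ∀ {n} {m x y : M} (m' : M) {c : V n} {d : V (n + 1)}, Col m d →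
    le (x, c, y) (1, d, 1) → Col x c → lt (m * x, c, y * m') (m * head d, tail d, m')

namespace StringRewriting.NormalForms

variable {M : Type u} [Monoid M] {A : Type v} (N : NormalForms M A)

/-- The word `s` does not overlap reducibly with the first entry of `c`; for empty `c` it is the
empty word. -/
def Free (s : List A) : List M → Prop
  | [] => s = []
  | w :: _ => N.Irr (s ++ N.nf w)

/-- Anick chains, with entries in `M` (standing for their normal forms) and grown to the left: each
new entry is the shortest word that is not free for the chain so far. So the last entry is a letter,
and every product of two successive entries is reducible, while its proper suffixes are not. -/
def IsChain : List M → Prop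
  | [] => True
  | u :: c => IsChain c ∧ ¬ N.Free (N.nf u) c ∧ ∀ s, s <:+ N.nf u → s ≠ N.nf u → N.Free s c

/-- The word spelled by a list of elements of `M`. -/
def flat : List M → List A
  | [] => []
  | u :: c => N.nf u ++ flat c

/-- The sum of the lengths of the suffixes of `flat c` that start at an entry of `c` or at the end,
where each of them is prolonged by `k` letters. -/
def suffixSum : List M → ℕ → ℕ
  | [], k => k
  | u :: c, k => (N.flat (u :: c)).length + k + suffixSum c k

variable {N}

theorem Free.of_suffix {s t : List A} {c : List M} (h : N.Free t c) (hs : s <:+ t) :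
    N.Free s c := by
  cases c with
  | nil =>
    have : t = [] := h
    subst this
    exact List.suffix_nil.1 hs
  | cons w c =>
    obtain ⟨p, rfl⟩ := hs
    exact Irr.right (x := p) (by simpa [Free] using h)

/-- A word that is not free has a shortest suffix that is not free. -/
theorem exists_shortest_suffix {s : List A} {c : List M} (h : ¬ N.Free s c) :
    ∃ p t, s = p ++ t ∧ ¬ N.Free t c ∧ ∀ q, q <:+ t → q ≠ t → N.Free q c := by
  induction s with
  | nil => exact ⟨[], [], rfl, h, fun q hq hne => (hne (by simpa using hq)).elim⟩
  | cons a s ih =>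
    by_cases hs : N.Free s c
    · refine ⟨[], a :: s, rfl, h, fun q hq hne => ?_⟩
      rcases List.suffix_cons_iff.1 hq with hq | hq
      · exact (hne hq).elim
      · exact hs.of_suffix hq
    · obtain ⟨p, t, rfl, ht⟩ := ih hs
      exact ⟨a :: p, t, rfl, ht⟩

/-- The entries of chains have bounded length: deleting the first letter of an entry leaves a free
word, so the minimal reducible words that witness non-freeness start with that letter. -/
theorem IsChain.length_head_le {L : ℕ} (hL : ∀ w, N.nf (N.ev w) ≠ w →
    ∃ p l q, w = p ++ l ++ q ∧ l.length ≤ L ∧ N.nf (N.ev l) ≠ l) {u : M} {c : List M}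
    (h : N.IsChain (u :: c)) : (N.nf u).length ≤ L + 1 := by
  obtain ⟨-, h₁, h₂⟩ := h
  rcases hu : N.nf u with _ | ⟨a, s⟩
  · simp
  have hs : N.Free s c := h₂ s (by simp [hu]) (by simp [hu])
  cases c with
  | nil =>
    have : s = [] := hs
    simp [this]
  | cons w c =>
    obtain ⟨p, l, q, e, hl, hl'⟩ := hL _ h₁
    rw [hu] at e
    rcases p with _ | ⟨b, p⟩
    · by_contra hlt
      have hpre : l <+: N.nf u := by
        rw [hu]
        refine List.prefix_of_prefix_length_le (l₃ := a :: s ++ N.nf w) ⟨q, ?_⟩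
          (List.prefix_append _ _) (by omega)
        rw [e]; simp
      obtain ⟨t, ht⟩ := hpre
      exact hl' (Irr.left (y := t) (ht ▸ N.irr_nf u))
    · have e' : s ++ N.nf w = p ++ l ++ q := by simpa using (List.cons_eq_cons.1 e).2
      have hs' : N.Irr (s ++ N.nf w) := hs
      exact (hl' (Irr.infix (e' ▸ hs'))).elim

theorem finite_chains [Finite A] (n : ℕ) : Finite {c : List M // N.IsChain c ∧ c.length = n} := by
  obtain ⟨L, hL⟩ := N.bound
  have hS : Finite {m : M // (N.nf m).length ≤ L + 1} := by
    have := (List.finite_length_le A (L + 1)).to_subtype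
    exact Finite.of_injective
      (fun m : {m : M // (N.nf m).length ≤ L + 1} =>
        (⟨N.nf m.1, m.2⟩ : {l : List A | l.length ≤ L + 1}))
      fun a b h => Subtype.ext (N.nf_injective (congrArg Subtype.val h))
  induction n with
  | zero =>
    refine @Finite.of_subsingleton _ ⟨fun a b => Subtype.ext ?_⟩
    rw [List.length_eq_zero_iff.1 a.2.2, List.length_eq_zero_iff.1 b.2.2]
  | succ n ih =>
    let f : {c : List M // N.IsChain c ∧ c.length = n + 1} →
        {m : M // (N.nf m).length ≤ L + 1} × {c : List M // N.IsChain c ∧ c.length = n} :=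
      fun c => match c with
        | ⟨u :: c, h⟩ => (⟨u, h.1.length_head_le hL⟩, ⟨c, h.1.1, by simpa using h.2⟩)
    refine Finite.of_injective f ?_
    rintro ⟨_ | ⟨a, c⟩, h⟩ ⟨_ | ⟨b, d⟩, h'⟩ e
    · rfl
    · simp at h
    · simp at h'
    · simp only [f, Prod.mk.injEq, Subtype.mk.injEq] at e
      simp [e.1, e.2]

/-- Of two chains with equally many entries inside the same word, the one that ends at the end of
the word starts last. -/
theorem IsChain.length_flat_le : ∀ {c d : List M}, N.IsChain c → N.IsChain d →
    c.length = d.length → ∀ {y W : List A}, N.flat c ++ y <:+ W → N.flat d <:+ W →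
    (N.flat d).length ≤ (N.flat c ++ y).length
  | [], [], _, _, _, _, _, _, _ => by simp [flat]
  | [v], [w], hc, hd, _, y, W, _, _ => by
    have hv : 1 ≤ (N.nf v).length := List.length_pos_iff.2 hc.2.1
    have hw : (N.nf w).length ≤ 1 := by
      rcases hw : N.nf w with _ | ⟨a, s⟩
      · simp
      · have : s = [] := hd.2.2 s (by simp [hw]) (by simp [hw])
        simp [this]
    simp only [flat, List.append_nil, List.length_append]
    omega
  | v :: v' :: c, w :: w' :: d, hc, hd, hl, y, W, hcW, hdW => by
    have ih : (N.flat d).length ≤ (N.flat c ++ y).length := by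
      refine IsChain.length_flat_le hc.1.1 hd.1.1 (by simpa using hl) (W := W) ?_ ?_
      · exact (List.IsSuffix.trans ⟨N.nf v ++ N.nf v', by simp [flat]⟩ hcW)
      · exact (List.IsSuffix.trans ⟨N.nf w ++ N.nf w', by simp [flat]⟩ hdW)
    have hdc : N.flat d <:+ N.flat c ++ y := List.suffix_of_suffix_length_le (l₃ := W)
      (List.IsSuffix.trans ⟨N.nf w ++ N.nf w', by simp [flat]⟩ hdW)
      (List.IsSuffix.trans ⟨N.nf v ++ N.nf v', by simp [flat]⟩ hcW) ih
    obtain ⟨z, hz⟩ := hdc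
    by_contra hlt
    obtain ⟨r, hr⟩ := List.suffix_of_suffix_length_le hcW hdW (by omega)
    have hr' : r ++ (N.nf v ++ N.nf v' ++ z) = N.nf w ++ N.nf w' := by
      refine List.append_cancel_right (bs := N.flat d) ?_
      simp only [flat, List.append_assoc, ← hz] at hr ⊢
      exact hr
    have hr0 : r ≠ [] := by
      rintro rfl
      rw [List.nil_append] at hr
      rw [hr] at hlt
      exact hlt le_rfl
    rcases hw : N.nf w with _ | ⟨a, s⟩
    · refine hd.2.1 ?_
      simpa [Free, hw] using N.irr_nf w'
    · obtain ⟨b, r, rfl⟩ := List.exists_cons_of_ne_nil hr0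
      rw [hw] at hr'
      have hr'' : r ++ (N.nf v ++ N.nf v' ++ z) = s ++ N.nf w' := by
        simpa using (List.cons_eq_cons.1 hr').2
      have hs : N.Irr (s ++ N.nf w') := hd.2.2 s (by simp [hw]) (by simp [hw])
      rw [← hr''] at hs
      exact hc.2.1 hs.right.left

/-- Among all chains with equally many entries inside a word, the chain at the end of the word, if
there is one, has the least sum of suffix lengths, and no other chain attains it. -/
theorem IsChain.suffixSum_le {c d : List M} (hc : N.IsChain c) (hd : N.IsChain d)
    (hl : c.length = d.length) {y W : List A} (hcW : N.flat c ++ y <:+ W) (hdW : N.flat d <:+ W) :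
    N.suffixSum d 0 ≤ N.suffixSum c y.length ∧
      (N.suffixSum d 0 = N.suffixSum c y.length → c = d ∧ y = []) := by
  induction c generalizing d with
  | nil =>
    obtain rfl : d = [] := by simpa using hl.symm
    simp [suffixSum, eq_comm]
  | cons v c ih =>
    rcases d with _ | ⟨w, d⟩
    · simp at hl
    have h₁ := IsChain.length_flat_le hc hd hl hcW hdW
    have h₂ := ih hc.1 hd.1 (by simpa using hl)
      (List.IsSuffix.trans ⟨N.nf v, by simp [flat]⟩ hcW)
      (List.IsSuffix.trans ⟨N.nf w, by simp [flat]⟩ hdW)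
    rw [List.length_append] at h₁
    simp only [suffixSum]
    refine ⟨by omega, fun h => ?_⟩
    obtain ⟨rfl, rfl⟩ := h₂.2 (by omega)
    refine ⟨?_, rfl⟩
    have h₃ : N.flat (w :: c) = N.flat (v :: c) := by
      refine (List.suffix_of_suffix_length_le hdW (by simpa using hcW) ?_).eq_of_length ?_ <;>
      simp only [List.length_nil] at h h₁ <;> omega
    rw [N.nf_injective (List.append_cancel_right h₃)]

theorem suffixSum_add (c : List M) (k j : ℕ) :
    N.suffixSum c (k + j) = N.suffixSum c k + (c.length + 1) * j := by
  induction c with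
  | nil => simp [suffixSum]
  | cons u c ih =>
    simp only [suffixSum, ih, List.length_cons]
    ring

theorem suffixSum_le (c : List M) (k : ℕ) :
    N.suffixSum c k ≤ (c.length + 1) * ((N.flat c).length + k) := by
  induction c with
  | nil => simp [suffixSum]
  | cons u c ih =>
    have : (c.length + 1) * ((N.flat c).length + k) ≤
        (c.length + 1) * ((N.flat (u :: c)).length + k) := by
      gcongr
      simp [flat]
    simp only [suffixSum, List.length_cons]
    nlinarith

theorem ev_flat (c : List M) : N.ev (N.flat c) = c.prod := by
  induction c with
  | nil => exact N.ev_nil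
  | cons u c ih => rw [flat, N.ev_append, N.ev_nf, ih, List.prod_cons]

variable (N)

/-- The word spelled by a cell. -/
def word (m : M) (c : List M) (m' : M) : List A := N.nf m ++ N.flat c ++ N.nf m'

variable {N}

theorem word_mul {m u : M} (c : List M) (m' : M) (h : N.Irr (N.nf m ++ N.nf u)) :
    N.word (m * u) c m' = N.word m (u :: c) m' := by
  rw [word, nf_mul h]
  simp [word, flat]

theorem red_word_mul (m u : M) (c : List M) (m' : M) :
    N.red (N.word m (u :: c) m') (N.word (m * u) c m') := by
  have := N.red_append [] (N.flat c ++ N.nf m') (N.red_nf_mul m u)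
  simpa [word, flat] using this

theorem red_word_translate (m m' x y : M) (c : List M) :
    N.red (N.nf m ++ N.word x c y ++ N.nf m') (N.word (m * x) c (y * m')) := by
  have h₁ := N.red_append [] (N.flat c ++ N.nf y ++ N.nf m') (N.red_nf_mul m x)
  have h₂ := N.red_append (N.nf (m * x) ++ N.flat c) [] (N.red_nf_mul y m')
  simp only [word, List.nil_append, List.append_nil, List.append_assoc] at h₁ h₂ ⊢
  exact N.red_trans h₁ h₂

theorem word_one (c : List M) : N.word 1 c 1 = N.flat c := by
  simp [word, nf_one]

/-- The order in which redundant cells are collapsed: the word of the cell gets reduced, or it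
stays and the entries of the chain move to the left. -/
def CellLT (N : NormalForms M A) (f e : M × List M × M) : Prop :=
  (N.red (N.word e.1 e.2.1 e.2.2) (N.word f.1 f.2.1 f.2.2) ∧
      N.word e.1 e.2.1 e.2.2 ≠ N.word f.1 f.2.1 f.2.2) ∨
    (N.word e.1 e.2.1 e.2.2 = N.word f.1 f.2.1 f.2.2 ∧
      N.suffixSum e.2.1 (N.nf e.2.2).length < N.suffixSum f.2.1 (N.nf f.2.2).length)

theorem cellLT_wf (n : ℕ) : WellFounded
    fun f e : M × {c : List M // N.IsChain c ∧ c.length = n} × M =>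
      N.CellLT (f.1, f.2.1.1, f.2.2) (e.1, e.2.1.1, e.2.2) := by
  refine Subrelation.wf ?_ (InvImage.wf
    (fun e : M × {c : List M // N.IsChain c ∧ c.length = n} × M =>
      (N.word e.1 e.2.1.1 e.2.2, (n + 1) * (N.word e.1 e.2.1.1 e.2.2).length -
        N.suffixSum e.2.1.1 (N.nf e.2.2).length)) (WellFounded.prod_lex N.wf wellFounded_lt))
  rintro ⟨x, ⟨c, hc, rfl⟩, y⟩ ⟨m, ⟨d, hd, hl⟩, m'⟩ (h | ⟨h, h'⟩)
  · exact Prod.Lex.left _ _ h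
  · simp only [InvImage] at h h' ⊢
    rw [h]
    refine Prod.Lex.right _ ?_
    have h₁ := N.suffixSum_le c (N.nf y).length
    have h₂ : (c.length + 1) * ((N.flat c).length + (N.nf y).length) ≤
        (c.length + 1) * (N.word x c y).length := by
      gcongr
      simp [word]
    omega

/-- The combinatorial core of the collapse. If reductions of the word of a chain `u :: d` lead to
the word of a cell `(x, c, y)` where `x` is free for `c`, then the translate of this cell is smaller
than the free face. This is clear if the word of the translate got reduced. Otherwise `c` lies
inside the word of `u :: d`, so its entries start no later than those of `d`, and equality would
mean `x = u`, which is not free. -/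
theorem cellLT_of_red {m x y u : M} (m' : M) {c d : List M} (hd : N.IsChain (u :: d))
    (hc : N.IsChain c) (hl : c.length = d.length) (hm : N.Irr (N.nf m ++ N.nf u))
    (h : N.red (N.word 1 (u :: d) 1) (N.word x c y)) (hx : N.Free (N.nf x) c) :
    N.CellLT (m * x, c, y * m') (m * u, d, m') := by
  have e₁ : N.word (m * u) d m' = N.nf m ++ N.word 1 (u :: d) 1 ++ N.nf m' := by
    rw [word_mul _ _ hm, word_one, word]
  have h₁ := N.red_append (N.nf m) (N.nf m') h
  have h₂ := N.red_word_translate m m' x y c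
  rw [← e₁] at h₁
  by_cases hne : N.word (m * u) d m' = N.word (m * x) c (y * m')
  · refine Or.inr ⟨hne, ?_⟩
    have e₂ : N.word (m * u) d m' = N.nf m ++ N.word x c y ++ N.nf m' :=
      N.red_antisymm h₁ (hne ▸ h₂)
    have e₃ : N.flat (u :: d) = N.word x c y := by
      rw [e₁, word_one] at e₂
      exact List.append_cancel_left (List.append_cancel_right e₂)
    have e₄ : N.nf (y * m') = N.nf y ++ N.nf m' := by
      have a₁ := N.red_append (N.nf m ++ N.nf x ++ N.flat c) [] (N.red_nf_mul y m')
      have a₂ := N.red_append [] (N.flat c ++ N.nf (y * m')) (N.red_nf_mul m x)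
      have a₃ := N.red_antisymm a₁ (by
        have : N.nf m ++ N.nf x ++ N.flat c ++ (N.nf y ++ N.nf m') ++ [] =
            N.word (m * x) c (y * m') := by
          rw [← hne, e₂]; simp [word]
        rw [this]
        simpa [word] using a₂)
      simpa using a₃.symm
    have hd' : N.flat d <:+ N.flat (u :: d) := ⟨N.nf u, rfl⟩
    have hc' : N.flat c ++ N.nf y <:+ N.flat (u :: d) := by
      rw [e₃]; exact ⟨N.nf x, by simp [word]⟩
    obtain ⟨h₃, h₄⟩ := IsChain.suffixSum_le hc hd.1 hl hc' hd'
    have h₅ : N.suffixSum d 0 ≠ N.suffixSum c (N.nf y).length := by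
      intro h
      obtain ⟨rfl, hy⟩ := h₄ h
      have : N.nf u = N.nf x := by
        simpa [flat, word, hy] using e₃
      exact hd.2.1 (this ▸ hx)
    have h₆ := N.suffixSum_add d 0 (N.nf m').length
    have h₇ := N.suffixSum_add c (N.nf y).length (N.nf m').length
    simp only [e₄, List.length_append]
    rw [hl] at h₇
    rw [zero_add] at h₆
    omega
  · exact Or.inl ⟨N.red_trans h₁ h₂, hne⟩

/-- The collapsing scheme given by the Anick chains. -/
def collapsingScheme [Finite A] (N : NormalForms M A) : CollapsingScheme M where
  V n := {c : List M // N.IsChain c ∧ c.length = n}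
  finite n := finite_chains n
  base := ⟨[], trivial, rfl⟩
  eq_base c := Subtype.ext (List.length_eq_zero_iff.1 c.2.2)
  head c := match c with
    | ⟨u :: _, _⟩ => u
  tail c := match c with
    | ⟨_ :: c, h⟩ => ⟨c, h.1.1, by simpa using h.2⟩
  val c := c.1.prod
  val_base := rfl
  val_succ d := match d with
    | ⟨_ :: _, _⟩ => rfl
  Col m c := N.Free (N.nf m) c.1
  col_base m := by
    change N.nf m = [] ↔ _
    rw [← N.nf_one]
    exact N.nf_injective.eq_iff
  not_col_tail := by
    rintro n m ⟨_ | ⟨u, c⟩, hd, hl⟩ h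
    · simp at hl
    · intro h'
      change N.Free (N.nf (m * u)) c at h'
      rw [N.nf_mul h] at h'
      exact hd.2.1 (h'.of_suffix (List.suffix_append _ _))
  exists_lift := by
    rintro n m ⟨c, hc, hl⟩ h
    obtain ⟨p, t, e, ht, ht'⟩ := exists_shortest_suffix h
    have hi : N.Irr (p ++ t) := e ▸ N.irr_nf m
    have hp : N.nf (N.ev p) = p := hi.left
    have htt : N.nf (N.ev t) = t := hi.right
    refine ⟨N.ev p, ⟨N.ev t :: c, ⟨hc, by rwa [htt], by rwa [htt]⟩, by simpa using hl⟩, ?_, ?_, rfl⟩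
    · change N.Irr (N.nf (N.ev p) ++ N.nf (N.ev t))
      rwa [hp, htt]
    · change N.ev p * N.ev t = m
      rw [← N.ev_append, ← e, N.ev_nf]
  lift_unique := by
    rintro n m₁ m₂ ⟨_ | ⟨u₁, c₁⟩, hd₁, hl₁⟩ ⟨_ | ⟨u₂, c₂⟩, hd₂, hl₂⟩ h₁ h₂ e e'
    · simp at hl₁
    · simp at hl₁
    · simp at hl₂
    · obtain rfl : c₁ = c₂ := congrArg Subtype.val e'
      change m₁ * u₁ = m₂ * u₂ at e
      have e₁ := congrArg N.nf e
      rw [N.nf_mul h₁, N.nf_mul h₂] at e₁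
      have e₂ : N.nf u₁ = N.nf u₂ := by
        rcases List.suffix_or_suffix_of_suffix (l₃ := N.nf m₂ ++ N.nf u₂) ⟨N.nf m₁, e₁⟩
          ⟨N.nf m₂, rfl⟩ with h | h
        · by_contra hne
          exact hd₁.2.1 (hd₂.2.2 _ h hne)
        · by_contra hne
          exact hd₂.2.1 (hd₁.2.2 _ h (Ne.symm hne))
      rw [e₂] at e₁
      obtain rfl := N.nf_injective e₂
      exact ⟨N.nf_injective (List.append_cancel_right e₁), rfl⟩
  le f e := N.red (N.word e.1 e.2.1.1 e.2.2) (N.word f.1 f.2.1.1 f.2.2)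
  le_refl _ := N.red_refl _
  le_trans h h' := N.red_trans h' h
  le_mul := by
    intro n k x y c c' m m' h
    have h₁ := N.red_append (N.nf m) (N.nf m') h
    refine N.red_trans ?_ (N.red_trans h₁ (red_word_translate _ _ _ _ _))
    simp only [word_one]
    exact N.red_refl _
  le_tail := by
    rintro n m m' ⟨_ | ⟨u, c⟩, hd, hl⟩
    · simp at hl
    · exact red_word_mul _ _ _ _
  le_of_col := by
    rintro n m m' ⟨_ | ⟨u, c⟩, hd, hl⟩ h
    · simp at hl
    · have := N.word_mul c m' h
      exact this ▸ N.red_refl _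
  le_base := by
    intro n m m' c
    have : N.word 1 [] (m * c.1.prod * m') = N.nf (N.ev (N.word m c.1 m')) := by
      simp [word, nf_one, flat, N.ev_append, N.ev_nf, ev_flat, mul_assoc]
    exact this ▸ N.red_nf _
  val_eq_of_le h := by
    have := (N.red_ev h).symm
    simpa [word, N.ev_append, N.ev_nf, ev_flat, mul_assoc] using this
  lt f e := N.CellLT (f.1, f.2.1.1, f.2.2) (e.1, e.2.1.1, e.2.2)
  lt_wf n := cellLT_wf n
  lt_of_le := by
    rintro n m x y m' ⟨c, hc, hl⟩ ⟨_ | ⟨u, d⟩, hd, hl'⟩ hm hle hx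
    · simp at hl'
    · exact cellLT_of_red m' hd hc (hl.trans (Nat.succ.inj hl').symm) hm hle hx

end StringRewriting.NormalForms

/-! ### The contracting homotopy of the chain complex of a collapsing scheme -/

namespace CollapsingScheme

open Finsupp

variable {M : Type u} [Monoid M] (S : CollapsingScheme M)

theorem val_eq_one (c : S.V 0) : S.val c = 1 := by rw [S.eq_base c, S.val_base]

theorem col_zero {m : M} {c : S.V 0} : S.Col m c ↔ m = 1 := by rw [S.eq_base c, S.col_base]

/-- The collapsible partner of a redundant cell. -/
noncomputable def partner {n : ℕ} {m : M} {c : S.V n} (h : ¬ S.Col m c) : M × S.V (n + 1) :=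
  ⟨(S.exists_lift h).choose, (S.exists_lift h).choose_spec.choose⟩

theorem partner_spec {n : ℕ} {m : M} {c : S.V n} (h : ¬ S.Col m c) :
    S.Col (S.partner h).1 (S.partner h).2 ∧ (S.partner h).1 * S.head (S.partner h).2 = m ∧
      S.tail (S.partner h).2 = c :=
  (S.exists_lift h).choose_spec.choose_spec

theorem partner_eq {n : ℕ} {m : M} {d : S.V (n + 1)} (hd : S.Col m d) :
    S.partner (S.not_col_tail hd) = (m, d) := by
  have h := S.partner_spec (S.not_col_tail hd)
  have := S.lift_unique h.1 hd h.2.1 h.2.2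
  exact Prod.ext this.1 this.2

/-- The free abelian group on the `n`-cells. -/
abbrev C (n : ℕ) := M × S.V n × M →₀ ℤ

variable {S}

/-- The two-sided translation `x ↦ m x m'`. -/
noncomputable def tr {n : ℕ} (m m' : M) : S.C n →ₗ[ℤ] S.C n :=
  lmapDomain ℤ ℤ fun e => (m * e.1, e.2.1, e.2.2 * m')

@[simp] theorem tr_single {n : ℕ} (m m' : M) (e : M × S.V n × M) (k : ℤ) :
    tr m m' (single e k) = single (m * e.1, e.2.1, e.2.2 * m') k := by
  simp [tr]

theorem tr_tr {n : ℕ} (a b a' b' : M) (x : S.C n) :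
    tr a a' (tr b b' x) = tr (a * b) (b' * a') x := by
  induction x using Finsupp.induction_linear with
  | zero => simp
  | add x y hx hy => simp only [map_add, hx, hy]
  | single e k => simp [mul_assoc]

/-- The bilinear extension of a map that is given on the cells `(1, c, 1)`. -/
noncomputable def ext {n k : ℕ} (f : S.V n → S.C k) : S.C n →ₗ[ℤ] S.C k :=
  linearCombination ℤ fun e => tr e.1 e.2.2 (f e.2.1)

@[simp] theorem ext_single {n k : ℕ} (f : S.V n → S.C k) (e : M × S.V n × M) (j : ℤ) :
    ext f (single e j) = j • tr e.1 e.2.2 (f e.2.1) := by simp [ext]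

theorem ext_tr {n k : ℕ} (f : S.V n → S.C k) (m m' : M) (x : S.C n) :
    ext f (tr m m' x) = tr m m' (ext f x) := by
  induction x using Finsupp.induction_linear with
  | zero => simp
  | add x y hx hy => simp only [map_add, hx, hy]
  | single e k => simp [tr_tr]

variable (S)

/-- The contraction in degree `n`, given the boundary map in degree `n + 1`. A redundant cell
`e = (m₁ * head d, tail d, m')` is swept across its partner `(m₁, d, m')` to the remaining part of
the boundary of the latter, which consists of smaller cells and is contracted recursively. -/
noncomputable def contractCell {n : ℕ} (b : S.V (n + 1) → S.C n) :
    M × S.V n × M → S.C (n + 1) :=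
  (S.lt_wf n).fix fun e rec => by
    classical
    exact if h : S.Col e.1 e.2.1 then 0 else
      single ((S.partner h).1, (S.partner h).2, e.2.2) 1 +
        linearCombination ℤ (fun g => if hg : S.lt g e then rec g hg else 0)
          (tr (S.partner h).1 e.2.2
            (single (S.head (S.partner h).2, S.tail (S.partner h).2, 1) 1 - b (S.partner h).2))

open Classical in
theorem contractCell_of_col {n : ℕ} (b : S.V (n + 1) → S.C n) {m : M} (m' : M) {d : S.V (n + 1)}
    (hd : S.Col m d) : S.contractCell b (m * S.head d, S.tail d, m') = single (m, d, m') 1 +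
      linearCombination ℤ (fun g => if S.lt g (m * S.head d, S.tail d, m') then
        S.contractCell b g else 0) (tr m m' (single (S.head d, S.tail d, 1) 1 - b d)) := by
  rw [contractCell, WellFounded.fix_eq, dif_neg (S.not_col_tail hd)]
  simp only [S.partner_eq hd, dite_eq_ite]

/-- The contraction in degree `n`, extended linearly from the cells. -/
noncomputable def contract {n : ℕ} (b : S.V (n + 1) → S.C n) : S.C n →ₗ[ℤ] S.C (n + 1) :=
  linearCombination ℤ (S.contractCell b)

/-- The boundary of the cell `(1, d, 1)`. -/
noncomputable def bd : ∀ n, S.V (n + 1) → S.C n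
  | 0, d => single (S.head d, S.tail d, 1) 1 - single (1, S.base, S.head d) 1
  | n + 1, d => single (S.head d, S.tail d, 1) 1 -
      S.contract (bd n) (tr (S.head d) 1 (bd n (S.tail d)))

/-- The boundary map from degree `n + 1` to degree `n`. -/
noncomputable abbrev D (n : ℕ) : S.C (n + 1) →ₗ[ℤ] S.C n := ext (S.bd n)

/-- The contraction from degree `n` to degree `n + 1`. -/
noncomputable abbrev H (n : ℕ) : S.C n →ₗ[ℤ] S.C (n + 1) := S.contract (S.bd n)

/-- The map to which the contraction joins the identity: the retraction onto the critical cells in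
degree `0`, and `H ∘ D` in positive degrees. -/
noncomputable def rem : ∀ n, S.C n →ₗ[ℤ] S.C n
  | 0 => lmapDomain ℤ ℤ fun e => (1, S.base, e.1 * e.2.2)
  | n + 1 => S.H n ∘ₗ S.D n

theorem bd_eq (n : ℕ) (d : S.V (n + 1)) : S.bd n d =
    single (S.head d, S.tail d, 1) 1 - S.rem n (single (S.head d, S.tail d, 1) 1) := by
  cases n <;> simp [bd, rem]

theorem D_single {n : ℕ} (m m' : M) (d : S.V (n + 1)) : S.D n (single (m, d, m') 1) =
    single (m * S.head d, S.tail d, m') 1 -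
      tr m m' (S.rem n (single (S.head d, S.tail d, 1) 1)) := by
  simp [D, bd_eq]

theorem H_single_of_col {n : ℕ} {m : M} (m' : M) {c : S.V n} (h : S.Col m c) (k : ℤ) :
    S.H n (single (m, c, m') k) = 0 := by
  rw [H, contract, linearCombination_single, contractCell, WellFounded.fix_eq]
  simp [h]

/-- All cells that occur in `x` are bounded by `e`. -/
def Below {n k : ℕ} (e : M × S.V k × M) (x : S.C n) : Prop := ∀ g ∈ x.support, S.le g e

/-- All cells that occur in `x` are collapsible or critical. -/
def ColSupp {n : ℕ} (x : S.C n) : Prop := ∀ g ∈ x.support, S.Col g.1 g.2.1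

variable {S}

theorem Below.add {n k : ℕ} {e : M × S.V k × M} {x y : S.C n} (hx : S.Below e x)
    (hy : S.Below e y) : S.Below e (x + y) := fun g hg => by
  classical
  rcases Finset.mem_union.1 (support_add hg) with h | h
  exacts [hx g h, hy g h]

theorem Below.neg {n k : ℕ} {e : M × S.V k × M} {x : S.C n} (hx : S.Below e x) :
    S.Below e (-x) := fun g hg => hx g (by simpa using hg)

theorem Below.trans {n k l : ℕ} {e : M × S.V k × M} {f : M × S.V l × M} {x : S.C n}
    (hx : S.Below e x) (h : S.le e f) : S.Below f x := fun g hg => S.le_trans (hx g hg) h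

theorem below_single {n k : ℕ} {e : M × S.V k × M} {g : M × S.V n × M} (h : S.le g e) (j : ℤ) :
    S.Below e (single g j) := fun f hf => by
  classical
  rw [Finset.mem_singleton.1 (support_single_subset hf)]
  exact h

theorem Below.tr {n k : ℕ} {c : S.V k} {x : S.C n} (hx : S.Below (1, c, 1) x) (m m' : M) :
    S.Below (m, c, m') (tr m m' x) := fun g hg => by
  classical
  obtain ⟨f, hf, rfl⟩ := Finset.mem_image.1 (mapDomain_support hg)
  exact S.le_mul m m' (hx f hf)

theorem colSupp_single {n : ℕ} {m : M} (m' : M) {c : S.V n} (h : S.Col m c) (j : ℤ) :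
    S.ColSupp (single (m, c, m') j) := fun f hf => by
  classical
  rw [Finset.mem_singleton.1 (support_single_subset hf)]
  exact h

theorem ColSupp.add {n : ℕ} {x y : S.C n} (hx : S.ColSupp x) (hy : S.ColSupp y) :
    S.ColSupp (x + y) := fun g hg => by
  classical
  rcases Finset.mem_union.1 (support_add hg) with h | h
  exacts [hx g h, hy g h]

theorem linearCombination_induction {n k : ℕ} {f : M × S.V n × M → S.C k} {p : S.C k → Prop}
    (h0 : p 0) (hadd : ∀ x y, p x → p y → p (x + y)) (hneg : ∀ (j : ℤ) x, p x → p (j • x))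
    {x : S.C n} (hx : ∀ g ∈ x.support, p (f g)) : p (linearCombination ℤ f x) := by
  rw [linearCombination_apply, Finsupp.sum]
  exact Finset.sum_induction _ p hadd h0 fun g hg => hneg _ _ (hx g hg)

theorem below_linearCombination {n k l : ℕ} {e : M × S.V l × M} {f : M × S.V n × M → S.C k}
    {x : S.C n} (hx : ∀ g ∈ x.support, S.Below e (f g)) : S.Below e (linearCombination ℤ f x) :=
  linearCombination_induction (fun g hg => by simp at hg) (fun _ _ => Below.add)
    (fun _ _ h g hg => h g (support_smul hg)) hx

theorem colSupp_linearCombination {n k : ℕ} {f : M × S.V n × M → S.C k}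
    {x : S.C n} (hx : ∀ g ∈ x.support, S.ColSupp (f g)) : S.ColSupp (linearCombination ℤ f x) :=
  linearCombination_induction (fun g hg => by simp at hg) (fun _ _ => ColSupp.add)
    (fun _ _ h g hg => h g (support_smul hg)) hx

variable (S)

/-- What the boundary map in degree `n + 1` needs for the contraction in degree `n` to work: apart
from the free face, the boundary of `(1, d, 1)` consists of collapsible or critical cells that are
bounded by `(1, d, 1)`. -/
def RemGood (n : ℕ) : Prop := ∀ d : S.V (n + 1),
  S.Below (1, d, 1) (S.rem n (single (S.head d, S.tail d, 1) 1)) ∧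
    S.ColSupp (S.rem n (single (S.head d, S.tail d, 1) 1))

variable {S}

theorem RemGood.lt {n : ℕ} (hS : S.RemGood n) {m : M} (m' : M) {d : S.V (n + 1)}
    (hd : S.Col m d) : ∀ g ∈ (tr m m' (S.rem n (single (S.head d, S.tail d, 1) 1))).support,
      S.lt g (m * S.head d, S.tail d, m') := fun g hg => by
  classical
  obtain ⟨f, hf, rfl⟩ := Finset.mem_image.1 (mapDomain_support hg)
  exact S.lt_of_le m' hd ((hS d).1 f hf) ((hS d).2 f hf)

theorem RemGood.H_single {n : ℕ} (hS : S.RemGood n) {m : M} (m' : M) {d : S.V (n + 1)}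
    (hd : S.Col m d) : S.H n (single (m * S.head d, S.tail d, m') 1) = single (m, d, m') 1 +
      S.H n (tr m m' (S.rem n (single (S.head d, S.tail d, 1) 1))) := by
  have h := hS.lt m' hd
  have e := S.contractCell_of_col (S.bd n) m' hd
  rw [bd_eq, sub_sub_cancel] at e
  rw [H, contract, linearCombination_single, one_smul, e, linearCombination_apply,
    linearCombination_apply]
  congr 1
  refine Finsupp.sum_congr fun g hg => ?_
  rw [if_pos (h g hg)]

/-- Induction over the redundant cells in the order in which they are collapsed. -/
theorem RemGood.induction {n : ℕ} (hS : S.RemGood n) {p : M × S.V n × M → Prop}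
    (hcol : ∀ m c m', S.Col m c → p (m, c, m'))
    (hred : ∀ m (d : S.V (n + 1)) m', S.Col m d →
      (∀ g ∈ (tr m m' (S.rem n (single (S.head d, S.tail d, 1) 1))).support, p g) →
        p (m * S.head d, S.tail d, m')) (e : M × S.V n × M) : p e := by
  induction e using (S.lt_wf n).induction with
  | _ e ih =>
    obtain ⟨m, c, m'⟩ := e
    by_cases h : S.Col m c
    · exact hcol m c m' h
    · obtain ⟨m₁, d, hd, rfl, rfl⟩ := S.exists_lift h
      exact hred _ _ _ hd fun g hg => ih g (hS.lt m' hd g hg)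

theorem RemGood.H_below {n : ℕ} (hS : S.RemGood n) (e : M × S.V n × M) :
    S.Below e (S.H n (single e 1)) ∧ S.ColSupp (S.H n (single e 1)) := by
  induction e using (S.lt_wf n).induction with
  | _ e ih =>
    obtain ⟨m, c, m'⟩ := e
    by_cases h : S.Col m c
    · rw [H_single_of_col _ _ h]
      exact ⟨fun g hg => by simp at hg, fun g hg => by simp at hg⟩
    · obtain ⟨m₁, d, hd, rfl, rfl⟩ := S.exists_lift h
      rw [hS.H_single m' hd]
      have hb := ((hS d).1.tr m₁ m').trans (S.le_of_col m' hd)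
      have ih' := fun g hg => ih g (hS.lt m' hd g hg)
      simp only [H, contract, linearCombination_single, one_smul] at ih'
      exact ⟨(below_single (S.le_of_col m' hd) 1).add
          (below_linearCombination fun g hg => (ih' g hg).1.trans (hb g hg)),
        (colSupp_single m' hd 1).add (colSupp_linearCombination fun g hg => (ih' g hg).2)⟩

theorem RemGood.D_below {n : ℕ} (hS : S.RemGood n) (e : M × S.V (n + 1) × M) :
    S.Below e (S.D n (single e 1)) := by
  obtain ⟨m, d, m'⟩ := e
  rw [D_single, sub_eq_add_neg]
  exact (below_single (S.le_tail m m' d) 1).add ((hS d).1.tr m m').neg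

theorem remGood (n : ℕ) : S.RemGood n := by
  induction n with
  | zero =>
    intro d
    simp only [rem, lmapDomain_apply, mapDomain_single, mul_one]
    refine ⟨below_single ?_ 1, colSupp_single _ (S.col_zero.2 rfl) 1⟩
    simpa [S.val_succ, S.val_eq_one] using S.le_base 1 1 d
  | succ n ih =>
    intro d
    have hD := (ih.D_below (S.head d, S.tail d, 1)).trans
      (by simpa using S.le_tail 1 1 d : S.le (S.head d, S.tail d, 1) (1, d, 1))
    have hH := ih.H_below
    simp only [H, contract, linearCombination_single, one_smul] at hH
    exact ⟨below_linearCombination fun g hg => (hH g).1.trans (hD g hg),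
      colSupp_linearCombination fun g _ => (hH g).2⟩

variable (S)

theorem linearMap_congr_support {n k : ℕ} {f g : S.C n →ₗ[ℤ] S.C k} {x : S.C n}
    (h : ∀ e ∈ x.support, f (single e 1) = g (single e 1)) : f x = g x := by
  rw [← x.sum_single, Finsupp.sum, map_sum, map_sum]
  refine Finset.sum_congr rfl fun e he => ?_
  rw [← mul_one (x e), ← smul_eq_mul, ← smul_single, map_smul, map_smul, h e he]

theorem linearMap_ext_single {n k : ℕ} {f g : S.C n →ₗ[ℤ] S.C k}
    (h : ∀ e, f (single e 1) = g (single e 1)) (x : S.C n) : f x = g x :=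
  S.linearMap_congr_support fun e _ => h e

/-- On the free face of a collapsible cell, `H` is that cell plus `H` of the remaining boundary, so
the identity follows by induction over the redundant cells, given that `rem` vanishes on boundaries.
-/
theorem D_H_of_rem_D {n : ℕ} (hn : ∀ x, S.rem n (S.D n x) = 0) (x : S.C n) :
    S.D n (S.H n x) = x - S.rem n x := by
  have hS := S.remGood n
  refine S.linearMap_ext_single (f := S.D n ∘ₗ S.H n) (g := LinearMap.id - S.rem n) ?_ x
  refine hS.induction ?_ ?_
  · intro m c m' h
    simp only [LinearMap.comp_apply, H_single_of_col _ _ h, map_zero, LinearMap.sub_apply,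
      LinearMap.id_apply]
    cases n with
    | zero =>
      obtain rfl := S.col_zero.1 h
      simp [rem, S.eq_base c]
    | succ n =>
      simp [rem, -ext_single, D_single, map_sub, (S.remGood n).H_single m' h]
  · intro m d m' hd ih
    have h₁ : S.D n (S.H n (tr m m' (S.rem n (single (S.head d, S.tail d, 1) 1)))) = _ :=
      S.linearMap_congr_support (f := S.D n ∘ₗ S.H n) ih
    have h₂ := hn (single (m, d, m') 1)
    rw [D_single, map_sub, sub_eq_zero] at h₂
    simp only [LinearMap.sub_apply, LinearMap.id_apply] at h₁ ⊢
    rw [LinearMap.comp_apply, hS.H_single m' hd, map_add, h₁, D_single, h₂]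
    abel

theorem rem_D (n : ℕ) (x : S.C (n + 1)) : S.rem n (S.D n x) = 0 := by
  induction n with
  | zero =>
    refine S.linearMap_ext_single (f := S.rem 0 ∘ₗ S.D 0) (g := 0) ?_ x
    rintro ⟨m, d, m'⟩
    rw [LinearMap.comp_apply, D_single, map_sub]
    simp [rem, mul_assoc]
  | succ n ih =>
    have h : ∀ e, S.D n (S.D (n + 1) (single e 1)) = 0 := by
      rintro ⟨m, d, m'⟩
      have h := S.D_H_of_rem_D ih (S.D n (single (S.head d, S.tail d, 1) 1))
      rw [ih, sub_zero] at h
      rw [D, ext_single, one_smul, ext_tr, bd_eq, map_sub]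
      change tr m m' (_ - S.D n (S.H n _)) = 0
      rw [h, sub_self, map_zero]
    refine S.linearMap_ext_single (f := S.rem (n + 1) ∘ₗ S.D (n + 1)) (g := 0) (fun e => ?_) x
    simp only [LinearMap.comp_apply, rem, h, map_zero, LinearMap.zero_apply]

/-- The contracting homotopy: `D H + H D = 1` in positive degrees, and in degree `0` the map `D H`
is the identity minus the retraction onto the critical cells. -/
theorem D_H (n : ℕ) (x : S.C n) : S.D n (S.H n x) = x - S.rem n x :=
  S.D_H_of_rem_D (S.rem_D n) x

theorem D_D (n : ℕ) (x : S.C (n + 2)) : S.D n (S.D (n + 1) x) = 0 := by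
  have h := S.D_H n (S.D n (S.D (n + 1) x))
  have h' := S.rem_D (n + 1) x
  rw [S.rem_D, sub_zero] at h
  rw [← h]
  change S.D n (S.rem (n + 1) _) = 0
  rw [h', map_zero]

/-- The contraction is right `M`-linear, although it is not left `M`-linear. -/
theorem H_tr_right (n : ℕ) (t : M) (x : S.C n) : S.H n (tr 1 t x) = tr 1 t (S.H n x) := by
  have hS := S.remGood n
  refine S.linearMap_ext_single (f := S.H n ∘ₗ tr 1 t) (g := tr 1 t ∘ₗ S.H n) ?_ x
  refine hS.induction ?_ ?_
  · intro m c m' h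
    simp only [LinearMap.comp_apply, tr_single, one_mul, H_single_of_col _ _ h, map_zero]
  · intro m d m' hd ih
    have h := S.linearMap_congr_support ih
    simp only [LinearMap.comp_apply, tr_tr, one_mul] at h ⊢
    rw [tr_single, one_mul, hS.H_single _ hd, hS.H_single _ hd, map_add, h, tr_single, one_mul]

end CollapsingScheme

/-! ### Free resolutions -/

/-- Data by which a monoid `N` acts freely on `M × T`, for a left `M`-set `T`: the monoid `N` acts
on `M` through a homomorphism `proj` and left multiplication, it acts on `T` by maps that commute with
the action of `M`, and `n ↦ n • (1, pt)` is a bijection `N → M × T` with inverse `coord`.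

The two instances of interest are `N = M × Mᵐᵒᵖ` with `T = M`, and `N = M` with `T` a point. -/
structure Frame (M N T : Type u) [Monoid M] [Monoid N] where
  proj : N →* M
  left : M → T → T
  right : N → T → T
  left_one : ∀ t, left 1 t = t
  left_mul : ∀ a b t, left (a * b) t = left a (left b t)
  right_one : ∀ t, right 1 t = t
  right_mul : ∀ a b t, right (a * b) t = right a (right b t)
  comm : ∀ n m t, right n (left m t) = left m (right n t)
  pt : T
  coord : M × T → N
  coord_apply : ∀ n, coord (proj n, right n pt) = n
  proj_coord : ∀ p, proj (coord p) = p.1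
  right_coord : ∀ p, right (coord p) pt = p.2

namespace Frame

variable {M N T : Type u} [Monoid M] [Monoid N] (F : Frame M N T)

theorem mul_coord (n : N) (m : M) (t : T) :
    n * F.coord (m, t) = F.coord (F.proj n * m, F.right n t) := by
  rw [← F.coord_apply (n * F.coord (m, t)), F.right_mul, map_mul, F.proj_coord, F.right_coord]

end Frame

namespace CollapsingScheme

open Finsupp MonoidAlgebra

variable {M N T : Type u} [Monoid M] [Monoid N] (S : CollapsingScheme M) (F : Frame M N T)

/-- The map that sends the cell `(m, c, m')` to the cell `(m, c, m' t)`. Here the cells with last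
component in `T` are regarded as a basis of the free module on `S.V n`. -/
noncomputable def push (n : ℕ) (t : T) : S.C n →ₗ[ℤ] (S.V n →₀ MonoidAlgebra ℤ N) :=
  linearCombination ℤ fun e =>
    Finsupp.single e.2.1 (MonoidAlgebra.single (F.coord (e.1, F.left e.2.2 t)) 1)

variable {S F}

@[simp] theorem push_single {n : ℕ} (t : T) (m m' : M) (c : S.V n) : S.push F n t
    (Finsupp.single (m, c, m') 1) =
      Finsupp.single c (MonoidAlgebra.single (F.coord (m, F.left m' t)) 1) := by
  simp [push]

theorem single_eq_push {n : ℕ} (c : S.V n) (a : N) :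
    Finsupp.single c (MonoidAlgebra.single a 1) =
      S.push F n (F.right a F.pt) (Finsupp.single (F.proj a, c, 1) 1) := by
  rw [push_single, F.left_one, F.coord_apply]

theorem smul_push {n : ℕ} (a : N) (t : T) (x : S.C n) :
    (MonoidAlgebra.single a 1 : MonoidAlgebra ℤ N) • S.push F n t x =
      S.push F n (F.right a t) (tr (F.proj a) 1 x) := by
  induction x using Finsupp.induction_linear with
  | zero => simp
  | add x y hx hy => simp only [map_add, smul_add, hx, hy]
  | single e k =>
    rw [← mul_one k, ← smul_eq_mul, ← Finsupp.smul_single, map_smul, map_smul, map_smul,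
      smul_comm, push_single, tr_single, push_single]
    simp [F.mul_coord, F.comm]

theorem push_tr_right {n : ℕ} (t : T) (m : M) (x : S.C n) :
    S.push F n t (tr 1 m x) = S.push F n (F.left m t) x := by
  induction x using Finsupp.induction_linear with
  | zero => simp
  | add x y hx hy => simp only [map_add, hx, hy]
  | single e k => simp [push, F.left_mul]

/-- Two additive maps agree if they agree on the basis elements, seen as images of cells. -/
theorem addHom_ext_push {n : ℕ} {G : Type*} [AddCommGroup G]
    {f g : (S.V n →₀ MonoidAlgebra ℤ N) →+ G}
    (h : ∀ t m c, f (S.push F n t (Finsupp.single (m, c, 1) 1)) =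
      g (S.push F n t (Finsupp.single (m, c, 1) 1))) (x : S.V n →₀ MonoidAlgebra ℤ N) :
    f x = g x := by
  refine DFunLike.congr_fun (Finsupp.addHom_ext' fun c => ?_) x
  refine MonoidAlgebra.addHom_ext' fun a => ?_
  refine AddMonoidHom.ext_int ?_
  have := h (F.right a F.pt) (F.proj a) c
  rwa [← single_eq_push] at this

variable (S F)

/-- The boundary map of the free resolution. -/
noncomputable def bdry (n : ℕ) :
    (S.V (n + 1) →₀ MonoidAlgebra ℤ N) →ₗ[MonoidAlgebra ℤ N] (S.V n →₀ MonoidAlgebra ℤ N) :=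
  linearCombination _ fun c => S.push F n F.pt (S.bd n c)

/-- The additive map induced by the contraction `S.H`, which is not `N`-linear. -/
noncomputable def htpy (n : ℕ) :
    (S.V n →₀ MonoidAlgebra ℤ N) →+ (S.V (n + 1) →₀ MonoidAlgebra ℤ N) :=
  Finsupp.liftAddHom fun c => (Finsupp.liftAddHom fun a => zmultiplesHom _
    (S.push F (n + 1) (F.right a F.pt) (S.H n (Finsupp.single (F.proj a, c, 1) 1)))).comp
      (MonoidAlgebra.coeffAddEquiv (R := ℤ) (M := N)).toAddMonoidHom

/-- Two additive maps on the free abelian group on the cells agree if they agree on the cells. -/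
theorem linear_push {n : ℕ} {G : Type*} [AddCommGroup G] {f g : S.C n →+ G}
    (h : ∀ m c m', f (Finsupp.single (m, c, m') 1) = g (Finsupp.single (m, c, m') 1)) (x : S.C n) :
    f x = g x := by
  refine DFunLike.congr_fun (Finsupp.addHom_ext' fun e => ?_) x
  exact AddMonoidHom.ext_int (h _ _ _)

theorem bdry_push (n : ℕ) (t : T) (x : S.C (n + 1)) :
    S.bdry F n (S.push F (n + 1) t x) = S.push F n t (S.D n x) := by
  refine linear_push S (f := ((S.bdry F n).toAddMonoidHom.comp (S.push F (n + 1) t).toAddMonoidHom))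
    (g := (S.push F n t ∘ₗ S.D n).toAddMonoidHom) (fun m c m' => ?_) x
  change S.bdry F n (S.push F (n + 1) t _) = S.push F n t (S.D n _)
  rw [push_single, bdry, linearCombination_single, smul_push, F.right_coord, F.proj_coord,
    ← push_tr_right, tr_tr]
  simp [D]

theorem htpy_push (n : ℕ) (t : T) (x : S.C n) :
    S.htpy F n (S.push F n t x) = S.push F (n + 1) t (S.H n x) := by
  refine linear_push S (f := ((S.htpy F n).comp (S.push F n t).toAddMonoidHom))
    (g := (S.push F (n + 1) t ∘ₗ S.H n).toAddMonoidHom) (fun m c m' => ?_) x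
  change S.htpy F n (S.push F n t _) = S.push F (n + 1) t (S.H n _)
  have h := S.H_tr_right n m' (Finsupp.single (m, c, 1) 1)
  rw [tr_single, one_mul, one_mul] at h
  rw [h, push_tr_right, push_single]
  simp [htpy, F.right_coord, F.proj_coord]

theorem bdry_bdry (n : ℕ) (x : S.V (n + 2) →₀ MonoidAlgebra ℤ N) :
    S.bdry F n (S.bdry F (n + 1) x) = 0 := by
  refine addHom_ext_push (F := F)
    (f := (S.bdry F n).toAddMonoidHom.comp (S.bdry F (n + 1)).toAddMonoidHom) (g := 0)
    (fun t m c => ?_) x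
  change S.bdry F n (S.bdry F (n + 1) _) = 0
  rw [bdry_push, bdry_push, D_D, map_zero]

theorem bdry_htpy (n : ℕ) (x : S.V (n + 1) →₀ MonoidAlgebra ℤ N) :
    S.bdry F (n + 1) (S.htpy F (n + 1) x) = x - S.htpy F n (S.bdry F n x) := by
  refine addHom_ext_push (F := F)
    (f := (S.bdry F (n + 1)).toAddMonoidHom.comp (S.htpy F (n + 1)))
    (g := AddMonoidHom.id _ - (S.htpy F n).comp (S.bdry F n).toAddMonoidHom)
    (fun t m c => ?_) x
  change S.bdry F (n + 1) (S.htpy F (n + 1) _) = _ - S.htpy F n (S.bdry F n _)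
  rw [htpy_push, bdry_push, bdry_push, htpy_push, D_H, map_sub]
  rfl

/-- The complex of a collapsing scheme is a finitely generated free resolution of any module that is
freely generated as an abelian group by the elements `e t` for `t : T`, on which `N` acts by
`n • e t = e (proj n • right n t)`; the map `σ` exhibits the `e t` as independent. -/
theorem fpInftyModule {V : Type w} [AddCommGroup V] [Module (MonoidAlgebra ℤ N) V] (e : T → V)
    (he : ∀ (n : N) t, (MonoidAlgebra.single n 1 : MonoidAlgebra ℤ N) • e t =
      e (F.left (F.proj n) (F.right n t)))
    (hspan : ∀ f g : V →+ V, (∀ t, f (e t) = g (e t)) → f = g)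
    (σ : V →+ (S.V 0 →₀ MonoidAlgebra ℤ N))
    (hσ : ∀ t, σ (e t) = S.push F 0 t (Finsupp.single (1, S.base, 1) 1)) :
    MonoidTopology.FPInftyModule (MonoidAlgebra ℤ N) V := by
  let ε : (S.V 0 →₀ MonoidAlgebra ℤ N) →ₗ[MonoidAlgebra ℤ N] V :=
    linearCombination _ fun _ => e F.pt
  have hε : ∀ t m c m', ε (S.push F 0 t (Finsupp.single (m, c, m') 1)) =
      e (F.left (m * m') t) := by
    intro t m c m'
    rw [push_single]
    simp [ε, he, F.proj_coord, F.right_coord, F.left_mul]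
  have hεσ : ∀ x, ε (σ x) = x := by
    refine DFunLike.congr_fun (hspan (ε.toAddMonoidHom.comp σ) (AddMonoidHom.id V) fun t => ?_)
    change ε (σ (e t)) = e t
    rw [hσ, hε, one_mul, F.left_one]
  have hrem : ∀ t x, σ (ε (S.push F 0 t x)) = S.push F 0 t (S.rem 0 x) := by
    intro t
    refine linear_push S (f := (σ.comp ε.toAddMonoidHom).comp (S.push F 0 t).toAddMonoidHom)
      (g := (S.push F 0 t ∘ₗ S.rem 0).toAddMonoidHom) fun m c m' => ?_
    change σ (ε (S.push F 0 t _)) = S.push F 0 t (S.rem 0 _)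
    rw [hε, hσ]
    simp only [rem, lmapDomain_apply, Finsupp.mapDomain_single, push_single, F.left_one]
  have hεd : ∀ x, ε (S.bdry F 0 x) = 0 := by
    refine addHom_ext_push (F := F) (f := ε.toAddMonoidHom.comp (S.bdry F 0).toAddMonoidHom)
      (g := 0) fun t m c => ?_
    change ε (S.bdry F 0 _) = 0
    rw [← hεσ (ε _), bdry_push, hrem, rem_D, map_zero, map_zero]
  have hdh : ∀ x, S.bdry F 0 (S.htpy F 0 x) = x - σ (ε x) := by
    refine addHom_ext_push (F := F) (f := (S.bdry F 0).toAddMonoidHom.comp (S.htpy F 0))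
      (g := AddMonoidHom.id _ - σ.comp ε.toAddMonoidHom) fun t m c => ?_
    change S.bdry F 0 (S.htpy F 0 _) = _ - σ (ε _)
    rw [htpy_push, bdry_push, D_H, map_sub, hrem]
    rfl
  refine ⟨fun n => S.V n →₀ MonoidAlgebra ℤ N, inferInstance, inferInstance, S.bdry F, ε,
    fun n => ⟨inferInstance, ?_⟩, fun n x => ⟨fun h => ?_, ?_⟩, fun x => ⟨fun h => ?_, ?_⟩,
    fun x => ⟨σ x, hεσ x⟩⟩
  · have := S.finite n
    infer_instance
  · exact ⟨S.htpy F (n + 1) x, by rw [bdry_htpy, h, map_zero, sub_zero]⟩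
  · rintro ⟨y, rfl⟩
    exact S.bdry_bdry F n y
  · exact ⟨S.htpy F 0 x, by rw [hdh, h, map_zero, sub_zero]⟩
  · rintro ⟨y, rfl⟩
    exact hεd y

end CollapsingScheme

namespace Frame

variable (M : Type u) [Monoid M]

/-- The frame for `M × Mᵐᵒᵖ` acting on `M × M`. -/
def bi : Frame M (M × Mᵐᵒᵖ) M where
  proj := MonoidHom.fst M Mᵐᵒᵖ
  left m t := m * t
  right n t := t * n.2.unop
  left_one := one_mul
  left_mul := mul_assoc
  right_one := mul_one
  right_mul a b t := (mul_assoc t _ _).symm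
  comm n m t := mul_assoc _ _ _
  pt := 1
  coord p := (p.1, .op p.2)
  coord_apply n := by simp
  proj_coord _ := rfl
  right_coord p := one_mul _

/-- The frame for `M` acting on `M × {pt}`. -/
def one : Frame M M PUnit.{u + 1} where
  proj := MonoidHom.id M
  left _ t := t
  right _ t := t
  left_one _ := rfl
  left_mul _ _ _ := rfl
  right_one _ := rfl
  right_mul _ _ _ := rfl
  comm _ _ _ := rfl
  pt := ⟨⟩
  coord p := p.1
  coord_apply _ := rfl
  proj_coord _ := rfl
  right_coord _ := rfl

end Frame

namespace CollapsingScheme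

variable {M : Type u} [Monoid M]

theorem leftFPInfty (S : CollapsingScheme M) : MonoidTopology.LeftFPInfty M := by
  refine S.fpInftyModule (Frame.one M) (fun _ => (1 : ℤ)) (fun n t => ?_) (fun f g h => ?_)
    (zmultiplesHom _ (S.push (Frame.one M) 0 ⟨⟩ (Finsupp.single (1, S.base, 1) 1)))
    (fun t => ?_)
  · exact (Representation.single_smul (ρ := Representation.trivial ℤ M ℤ) 1 n _).trans
      (one_smul _ _)
  · exact AddMonoidHom.ext_int (h ⟨⟩)
  · exact one_zsmul _

theorem biFPInfty (S : CollapsingScheme M) : MonoidTopology.BiFPInfty M := by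
  let _ : MulAction (M × Mᵐᵒᵖ) M := MonoidTopology.biAction M
  refine S.fpInftyModule (Frame.bi M)
    (V := (Representation.ofMulAction ℤ (M × Mᵐᵒᵖ) M).asModule)
    (fun t => (MonoidAlgebra.single t 1 : MonoidAlgebra ℤ M)) (fun n t => ?_) (fun f g h => ?_)
    ((Finsupp.liftAddHom fun t => zmultiplesHom _
      (S.push (Frame.bi M) 0 t (Finsupp.single (1, S.base, 1) 1))).comp
      (MonoidAlgebra.coeffAddEquiv (R := ℤ) (M := M)).toAddMonoidHom) (fun t => ?_)
  · refine (Representation.single_smul (ρ := Representation.ofMulAction ℤ (M × Mᵐᵒᵖ) M) 1 n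
      _).trans ((one_smul _ _).trans ((Representation.ofMulAction_single n t 1).trans ?_))
    congr 1
    exact mul_assoc _ _ _
  · exact MonoidAlgebra.addHom_ext' (f := f) (g := g) fun a => AddMonoidHom.ext_int (h a)
  · exact (Finsupp.liftAddHom_apply_single _ t (1 : ℤ)).trans (one_zsmul _)

end CollapsingScheme

/-! ### The points of the classifying space -/

/-- Every tail recursion has a solution, whether it terminates or not. -/
theorem exists_tailRec {σ ρ : Type*} [Inhabited ρ] (P : σ → Prop) (step : σ → σ) (out : σ → ρ) :
    ∃ r : σ → ρ, (∀ s, ¬ P s → r s = out s) ∧ ∀ s, P s → r s = r (step s) := by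
  classical
  let halt : σ → ℕ → Prop := fun s k => ¬ P (step^[k] s)
  refine ⟨fun s => if h : ∃ k, halt s k then out (step^[Nat.find h] s) else default,
    fun s hs => ?_, fun s hs => ?_⟩
  · have h : ∃ k, halt s k := ⟨0, hs⟩
    have h0 : Nat.find h = 0 := (Nat.find_eq_zero h).2 hs
    simp only [dif_pos h, h0, Function.iterate_zero, id]
  · by_cases h : ∃ k, halt (step s) k
    · have h' : ∃ k, halt s k := h.imp' (· + 1) fun k hk => hk
      have e : Nat.find h' = Nat.find h + 1 := Nat.find_comp_succ h' h (fun h => h hs)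
      simp only [dif_pos h, dif_pos h', e, Function.iterate_succ_apply]
    · have h' : ¬ ∃ k, halt s k := by
        rintro ⟨_ | k, hk⟩
        · exact hk hs
        · exact h ⟨k, hk⟩
      simp only [dif_neg h, dif_neg h']

/-! #### The flow on a cube

The cube of dimension `n + 1` has a bottom face, where the first coordinate is `-1`. The flow scales
the cube with center `(-3, 0, …, 0)` until the other faces are reached, where `gau` is `1`. -/

namespace Cube

variable {n : ℕ}

/-- The gauge function of the cube with respect to the center of the flow. On the cube it takes
values in `[1 / 2, 1]`, and it is `1` exactly on the faces other than the bottom. -/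
noncomputable def gau (z : Fin (n + 1) → ℝ) : ℝ := max ‖fun i : Fin n => z i.succ‖ ((z 0 + 3) / 4)

/-- Scaling by the factor `l` with center `(-3, 0, …, 0)`. -/
noncomputable def scl (l : ℝ) (z : Fin (n + 1) → ℝ) : Fin (n + 1) → ℝ :=
  Fin.cons (l * (z 0 + 3) - 3) (l • fun i : Fin n => z i.succ)

/-- The position at time `τ` of the point that starts at `z`. -/
noncomputable def flow (τ : ℝ) (z : Fin (n + 1) → ℝ) : Fin (n + 1) → ℝ :=
  scl (min (gau z + τ) 1 / gau z) z

/-- The time that is left after the flow from `z` for a time `τ`, in a scale that makes it `1` if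
`τ = 1`. -/
noncomputable def left (τ : ℝ) (z : Fin (n + 1) → ℝ) : ℝ := max (gau z + τ - 1) 0 / gau z

theorem norm_le_iff {z : Fin (n + 1) → ℝ} {r : ℝ} (hr : 0 ≤ r) :
    ‖z‖ ≤ r ↔ |z 0| ≤ r ∧ ‖fun i : Fin n => z i.succ‖ ≤ r := by
  rw [pi_norm_le_iff_of_nonneg hr, Fin.forall_fin_succ, pi_norm_le_iff_of_nonneg hr]
  rfl

theorem norm_lt_iff {z : Fin (n + 1) → ℝ} {r : ℝ} (hr : 0 < r) :
    ‖z‖ < r ↔ |z 0| < r ∧ ‖fun i : Fin n => z i.succ‖ < r := by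
  rw [pi_norm_lt_iff hr, Fin.forall_fin_succ, pi_norm_lt_iff hr]
  rfl

variable {z : Fin (n + 1) → ℝ} {τ : ℝ}

theorem gau_le (hz : ‖z‖ ≤ 1) : gau z ≤ 1 := by
  obtain ⟨h₁, h₂⟩ := (norm_le_iff zero_le_one).1 hz
  rw [abs_le] at h₁
  exact max_le h₂ (by linarith)

theorem le_gau (hz : ‖z‖ ≤ 1) : 1 / 2 ≤ gau z := by
  obtain ⟨h₁, -⟩ := (norm_le_iff zero_le_one).1 hz
  rw [abs_le] at h₁
  exact le_max_of_le_right (by linarith)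

theorem gau_scl {l : ℝ} (hl : 0 ≤ l) : gau (scl l z) = l * gau z := by
  simp only [gau, scl, Fin.cons_zero, Fin.cons_succ]
  rw [mul_max_of_nonneg _ _ hl]
  congr 1
  · exact (norm_smul l fun i : Fin n => z i.succ).trans (by rw [Real.norm_of_nonneg hl])
  · ring

theorem norm_scl_le (hz : ‖z‖ ≤ 1) {l : ℝ} (hl : 1 ≤ l) (h : l * gau z ≤ 1) : ‖scl l z‖ ≤ 1 := by
  obtain ⟨h₁, -⟩ := (norm_le_iff zero_le_one).1 hz
  rw [← gau_scl (by linarith), gau, max_le_iff] at h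
  rw [abs_le] at h₁
  rw [norm_le_iff zero_le_one, abs_le]
  refine ⟨⟨?_, by linarith⟩, h.1⟩
  simp only [scl, Fin.cons_zero]
  nlinarith

theorem norm_flow_le (hz : ‖z‖ ≤ 1) (hτ : 0 ≤ τ) : ‖flow τ z‖ ≤ 1 := by
  have h₁ := gau_le hz
  have h₂ := le_gau hz
  refine norm_scl_le hz ?_ ?_
  · rw [le_div_iff₀ (by linarith), one_mul]
    exact le_min (by linarith) h₁
  · rw [div_mul_cancel₀ _ (by linarith)]
    exact min_le_right _ _

theorem gau_flow (hz : ‖z‖ ≤ 1) (hτ : 0 ≤ τ) : gau (flow τ z) = min (gau z + τ) 1 := by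
  have h₂ := le_gau hz
  rw [flow, gau_scl, div_mul_cancel₀ _ (by linarith)]
  exact div_nonneg (le_min (by linarith) zero_le_one) (by linarith)

theorem scl_one : scl 1 z = z := by
  funext i
  refine Fin.cases ?_ (fun i => ?_) i <;> simp [scl]

theorem flow_zero (hz : ‖z‖ ≤ 1) : flow 0 z = z := by
  have h₁ := gau_le hz
  have h₂ := le_gau hz
  rw [flow, add_zero, min_eq_left h₁, div_self (by linarith), scl_one]

theorem flow_of_gau (hz : gau z = 1) (hτ : 0 ≤ τ) : flow τ z = z := by
  rw [flow, hz, min_eq_right (by linarith), div_self one_ne_zero, scl_one]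

theorem left_of_gau (hz : gau z = 1) (hτ : 0 ≤ τ) : left τ z = τ := by
  rw [left, hz, max_eq_left (by linarith)]
  ring

theorem left_of_le (h : gau z + τ ≤ 1) : left τ z = 0 := by
  rw [left, max_eq_right (by linarith), zero_div]

theorem left_one (hz : ‖z‖ ≤ 1) : left 1 z = 1 := by
  have h₂ := le_gau hz
  rw [left, max_eq_left (by linarith), add_sub_cancel_right, div_self (by linarith)]

theorem left_nonneg (hz : ‖z‖ ≤ 1) : 0 ≤ left τ z := by
  have h₂ := le_gau hz
  exact div_nonneg (le_max_right _ _) (by linarith)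

theorem left_le (hz : ‖z‖ ≤ 1) (hτ : τ ≤ 1) : left τ z ≤ 1 := by
  have h₂ := le_gau hz
  rw [left, div_le_one (by linarith)]
  exact max_le (by linarith) (by linarith)

theorem norm_of_gau (hz : ‖z‖ ≤ 1) (h : gau z = 1) : ‖z‖ = 1 := by
  refine le_antisymm hz (not_lt.1 fun hlt => ?_)
  obtain ⟨h₁, h₂⟩ := (norm_lt_iff zero_lt_one).1 hlt
  rw [abs_lt] at h₁
  have : gau z < 1 := max_lt h₂ (by linarith)
  linarith

/-- A point of the cube lies on an upper face, or in the interior of the bottom face, or in the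
interior. -/
theorem gau_eq_or (hz : ‖z‖ ≤ 1) : gau z = 1 ∨
    (z 0 = -1 ∧ ‖fun i : Fin n => z i.succ‖ < 1) ∨ ‖z‖ < 1 := by
  by_cases h : ‖z‖ < 1
  · exact Or.inr (Or.inr h)
  obtain ⟨h₁, h₂⟩ := (norm_le_iff zero_le_one).1 hz
  rw [norm_lt_iff zero_lt_one, not_and] at h
  rcases h₂.lt_or_eq with h₂ | h₂
  · have h₃ : |z 0| = 1 := le_antisymm h₁ (not_lt.1 fun h' => h h' h₂)
    rcases eq_or_eq_neg_of_abs_eq h₃ with h₃ | h₃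
    · left
      refine le_antisymm (gau_le hz) (le_max_of_le_right ?_)
      rw [h₃]; norm_num
    · exact Or.inr (Or.inl ⟨h₃, h₂⟩)
  · exact Or.inl (le_antisymm (gau_le hz) (le_max_of_le_left h₂.ge))

theorem norm_cons {b : Fin n → ℝ} (hb : ‖b‖ ≤ 1) :
    ‖(Fin.cons (-1) b : Fin (n + 1) → ℝ)‖ = 1 := by
  refine le_antisymm ((norm_le_iff zero_le_one).2 ⟨by simp, by simpa using hb⟩) ?_
  have := norm_le_pi_norm (Fin.cons (-1) b : Fin (n + 1) → ℝ) 0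
  simpa using this

theorem continuous_gau : Continuous (gau (n := n)) := by
  unfold gau
  fun_prop

theorem continuous_flow :
    Continuous fun p : ℝ × Metric.closedBall (0 : Fin (n + 1) → ℝ) 1 => flow p.1 p.2.1 := by
  have hg : Continuous fun p : ℝ × Metric.closedBall (0 : Fin (n + 1) → ℝ) 1 => gau p.2.1 :=
    continuous_gau.comp (by fun_prop)
  have hl : Continuous fun p : ℝ × Metric.closedBall (0 : Fin (n + 1) → ℝ) 1 =>
      min (gau p.2.1 + p.1) 1 / gau p.2.1 := by
    refine ((hg.add continuous_fst).min continuous_const).div hg fun p => ?_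
    have := le_gau (mem_closedBall_zero_iff.1 p.2.2)
    intro h; linarith
  have hz (i : Fin (n + 1)) :
      Continuous fun p : ℝ × Metric.closedBall (0 : Fin (n + 1) → ℝ) 1 => p.2.1 i :=
    (continuous_apply i).comp (continuous_subtype_val.comp continuous_snd)
  refine continuous_pi fun i => ?_
  refine Fin.cases ?_ (fun i => ?_) i
  · simp only [flow, scl, Fin.cons_zero]
    exact (hl.mul ((hz 0).add continuous_const)).sub continuous_const
  · simp only [flow, scl, Fin.cons_succ, Pi.smul_apply, smul_eq_mul]
    exact hl.mul (hz i.succ)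

theorem continuous_left :
    Continuous fun p : ℝ × Metric.closedBall (0 : Fin (n + 1) → ℝ) 1 => left p.1 p.2.1 := by
  have hg : Continuous fun p : ℝ × Metric.closedBall (0 : Fin (n + 1) → ℝ) 1 => gau p.2.1 :=
    continuous_gau.comp (by fun_prop)
  refine (((hg.add continuous_fst).sub continuous_const).max continuous_const).div hg fun p => ?_
  have := le_gau (mem_closedBall_zero_iff.1 p.2.2)
  intro h; linarith

end Cube

/-! ### The characteristic maps and the contraction -/

namespace CollapsingScheme

open Cube

variable {M : Type u} [Monoid M] (S : CollapsingScheme M)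

/-- A point of the complex: an `n`-cell together with a point of the open cube. -/
structure Pt where
  dim : ℕ
  cell : M × S.V dim × M
  pos : Fin dim → ℝ
  norm_lt : ‖pos‖ < 1

/-- The critical point that represents an element of the monoid. -/
def crit (t : M) : S.Pt := ⟨0, (1, S.base, t), 0, by rw [norm_zero]; exact zero_lt_one⟩

instance : Inhabited S.Pt := ⟨S.crit 1⟩

variable {S}

/-- The action of `M` on both sides. -/
def Pt.tr (m m' : M) (p : S.Pt) : S.Pt :=
  ⟨p.dim, (m * p.cell.1, p.cell.2.1, p.cell.2.2 * m'), p.pos, p.norm_lt⟩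

theorem Pt.tr_tr (a a' b b' : M) (p : S.Pt) : (p.tr b b').tr a a' = p.tr (a * b) (b' * a') := by
  simp [Pt.tr, mul_assoc]

theorem Pt.tr_one (p : S.Pt) : p.tr 1 1 = p := by
  simp [Pt.tr]

/-- The element of `M` that belongs to the component of a point. -/
def Pt.val (p : S.Pt) : M := p.cell.1 * S.val p.cell.2.1 * p.cell.2.2

theorem val_crit (t : M) : (S.crit t).val = t := by simp [Pt.val, crit, S.val_base]

theorem eq_crit {p : S.Pt} (h : p.dim = 0) (hc : S.Col p.cell.1 p.cell.2.1) :
    p = S.crit p.val := by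
  obtain ⟨n, ⟨m, c, m'⟩, x, hx⟩ := p
  obtain rfl : n = 0 := h
  obtain rfl := S.eq_base c
  obtain rfl := (S.col_base m).1 hc
  simp only [Pt.val, crit, S.val_base, one_mul, Pt.mk.injEq, heq_eq_eq, true_and]
  exact Subsingleton.elim _ _

variable (S)

/-- The points that are carried by cells of dimension less than `n`, or collapsible (or critical)
cells of dimension `n`. -/
def Y (n : ℕ) : Set S.Pt := {p | p.dim < n ∨ p.dim = n ∧ S.Col p.cell.1 p.cell.2.1}

/-- The box of a collapsible cell `(m, d, m')` consists of the interior of this cell and of the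
redundant cell that is its bottom face; here `z` is the position of the point `p` in the box. -/
def InBox {n : ℕ} (p : S.Pt) (m : M) (d : S.V (n + 1)) (m' : M) (z : Fin (n + 1) → ℝ) : Prop :=
  S.Col m d ∧ ((∃ h, z 0 = -1 ∧ p = ⟨n, (m * S.head d, S.tail d, m'), fun i => z i.succ, h⟩) ∨
    ∃ h, p = ⟨n + 1, (m, d, m'), z, h⟩)

variable {S}

theorem InBox.norm_le {n : ℕ} {p : S.Pt} {m : M} {d : S.V (n + 1)} {m' : M}
    {z : Fin (n + 1) → ℝ} (h : S.InBox p m d m' z) : ‖z‖ ≤ 1 := by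
  rcases h.2 with ⟨h, h0, -⟩ | ⟨h, -⟩
  · exact (norm_le_iff zero_le_one).2 ⟨by rw [h0]; simp, h.le⟩
  · exact h.le

theorem InBox.unique {n : ℕ} {p : S.Pt} {m m₁ : M} {d d₁ : S.V (n + 1)} {m' m₁' : M}
    {z z₁ : Fin (n + 1) → ℝ} (h : S.InBox p m d m' z) (h₁ : S.InBox p m₁ d₁ m₁' z₁) :
    m = m₁ ∧ d = d₁ ∧ m' = m₁' ∧ z = z₁ := by
  obtain ⟨hd, h⟩ := h
  obtain ⟨hd₁, h₁⟩ := h₁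
  rcases h with ⟨h, h0, rfl⟩ | ⟨h, rfl⟩ <;> rcases h₁ with ⟨h₁, h0₁, e⟩ | ⟨h₁, e⟩
  · simp only [Pt.mk.injEq, heq_eq_eq, true_and, Prod.mk.injEq] at e
    obtain ⟨rfl, rfl⟩ := S.lift_unique hd hd₁ e.1.1 e.1.2.1
    refine ⟨rfl, rfl, e.1.2.2, funext fun i => ?_⟩
    refine Fin.cases (h0.trans h0₁.symm) (fun i => ?_) i
    exact congrFun e.2 i
  · have := congrArg Pt.dim e
    simp at this
  · have := congrArg Pt.dim e
    simp at this
  · simp only [Pt.mk.injEq, heq_eq_eq, true_and, Prod.mk.injEq] at e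
    exact ⟨e.1.1, e.1.2.1, e.1.2.2, e.2⟩

theorem InBox.not_mem_Y {n : ℕ} {p : S.Pt} {m : M} {d : S.V (n + 1)} {m' : M}
    {z : Fin (n + 1) → ℝ} (h : S.InBox p m d m' z) : p ∉ S.Y n := by
  obtain ⟨hd, h⟩ := h
  rcases h with ⟨h, -, rfl⟩ | ⟨h, rfl⟩
  · rintro (h | ⟨-, h⟩)
    · exact lt_irrefl _ h
    · exact S.not_col_tail hd h
  · rintro (h | ⟨h, -⟩) <;> simp at h

theorem exists_inBox {n : ℕ} {p : S.Pt} (hp : p ∈ S.Y (n + 1)) (hp' : p ∉ S.Y n) :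
    ∃ m d m' z, S.InBox (n := n) p m d m' z := by
  obtain ⟨k, ⟨m, c, m'⟩, x, hx⟩ := p
  rcases hp with h | ⟨h, hc⟩
  · have hk : k = n := by
      by_contra hne
      exact hp' (Or.inl (lt_of_le_of_ne (Nat.lt_succ_iff.1 h) hne))
    subst hk
    have hc : ¬ S.Col m c := fun hc => hp' (Or.inr ⟨rfl, hc⟩)
    obtain ⟨m₁, d, hd, rfl, rfl⟩ := S.exists_lift hc
    exact ⟨m₁, d, m', Fin.cons (-1) x, hd, Or.inl ⟨by simpa using hx, by simp⟩⟩
  · obtain rfl : k = n + 1 := h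
    exact ⟨m, c, m', x, hc, Or.inr ⟨hx, rfl⟩⟩

/-- The characteristic map of `(1, d, 1)` on the cube, given the characteristic maps `χ` and the
contraction `h` one dimension lower. The bottom face is mapped to the redundant cell
`(head d, tail d, 1)`, the top face is mapped to the critical point, and the first coordinate of the
other faces is the time of the contraction applied to the boundary of the redundant cell. -/
noncomputable def attach {n : ℕ} (χ : S.V n → (Fin n → ℝ) → S.Pt) (h : ℝ → S.Pt → S.Pt)
    (d : S.V (n + 1)) (x : Fin (n + 1) → ℝ) : S.Pt := by
  classical
  exact if hx : ‖x‖ < 1 then ⟨n + 1, (1, d, 1), x, hx⟩ else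
    if ‖fun i : Fin n => x i.succ‖ < 1 then
      if x 0 < 0 then (χ (S.tail d) fun i => x i.succ).tr (S.head d) 1 else S.crit (S.val d)
    else h ((x 0 + 1) / 2) ((χ (S.tail d) fun i => x i.succ).tr (S.head d) 1)

/-- The contraction of the next dimension runs through the boxes one after the other: it follows the
flow of a box until this leaves the box, and starts again at the exit point. As a tail recursion,
this defines a map even before the process is known to stop. -/
theorem exists_sweep {n : ℕ} (χ : S.V (n + 1) → (Fin (n + 1) → ℝ) → S.Pt)
    (h : ℝ → S.Pt → S.Pt) : ∃ h' : ℝ → S.Pt → S.Pt,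
      (∀ τ p, (∀ m d m' z, ¬ S.InBox (n := n) p m d m' z) → h' τ p = h τ p) ∧
      (∀ τ p m d m' z, S.InBox p m d m' z → gau z + τ ≤ 1 →
        h' τ p = (χ d (flow τ z)).tr m m') ∧
      (∀ τ p m d m' z, S.InBox p m d m' z → 1 < gau z + τ →
        h' τ p = h' (left τ z) ((χ d (flow τ z)).tr m m')) := by
  classical
  let B := M × S.V (n + 1) × M × (Fin (n + 1) → ℝ)
  let In : S.Pt → B → Prop := fun p b => S.InBox p b.1 b.2.1 b.2.2.1 b.2.2.2
  by_cases hB : IsEmpty B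
  · exact ⟨h, fun _ _ _ => rfl, fun _ _ m d m' z => (hB.false (m, d, m', z)).elim,
      fun _ _ m d m' z => (hB.false (m, d, m', z)).elim⟩
  rw [not_isEmpty_iff] at hB
  let box : S.Pt → B := fun p => Classical.epsilon (In p)
  have hbox : ∀ {p m d m' z}, S.InBox p m d m' z → box p = (m, d, m', z) := by
    intro p m d m' z h
    have h' : In p (box p) := Classical.epsilon_spec (p := In p) ⟨(m, d, m', z), h⟩
    obtain ⟨h₁, h₂, h₃, h₄⟩ := h'.unique h
    exact Prod.ext h₁ (Prod.ext h₂ (Prod.ext h₃ h₄))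
  let dest : S.Pt × ℝ → S.Pt := fun s =>
    (χ (box s.1).2.1 (flow s.2 (box s.1).2.2.2)).tr (box s.1).1 (box s.1).2.2.1
  obtain ⟨r, hr, hr'⟩ := exists_tailRec
    (fun s : S.Pt × ℝ => (∃ b, In s.1 b) ∧ 1 < gau (box s.1).2.2.2 + s.2)
    (fun s => (dest s, left s.2 (box s.1).2.2.2))
    (fun s => if ∃ b, In s.1 b then dest s else h s.2 s.1)
  refine ⟨fun τ p => r (p, τ), fun τ p hp => ?_, fun τ p m d m' z hp hτ => ?_,
    fun τ p m d m' z hp hτ => ?_⟩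
  · have hn : ¬ ∃ b, In p b := fun ⟨b, hb⟩ => hp _ _ _ _ hb
    exact (hr (p, τ) fun h => hn h.1).trans (if_neg hn)
  · have e := hbox hp
    refine (hr (p, τ) fun h => ?_).trans ((if_pos ⟨(m, d, m', z), hp⟩).trans ?_)
    · simp only [e] at h
      linarith [h.2]
    simp only [dest, e]
  · have e := hbox hp
    refine (hr' (p, τ) ⟨⟨(m, d, m', z), hp⟩, by simpa only [e] using hτ⟩).trans ?_
    simp only [dest, e]

/-- The contraction in the next dimension. On the box of a collapsible cell, it follows the flow of
the cube, and continues from the exit point for the time that is left. -/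
noncomputable def sweep {n : ℕ} (χ : S.V (n + 1) → (Fin (n + 1) → ℝ) → S.Pt)
    (h : ℝ → S.Pt → S.Pt) : ℝ → S.Pt → S.Pt :=
  (exists_sweep χ h).choose

variable (S)

open Classical in
/-- The characteristic maps of the cells `(1, c, 1)` of dimension `n`, and the contraction of the
subset `S.Y n`. -/
noncomputable def stage : ∀ n, (S.V n → (Fin n → ℝ) → S.Pt) × (ℝ → S.Pt → S.Pt)
  | 0 => (fun c x => if hx : ‖x‖ < 1 then ⟨0, (1, c, 1), x, hx⟩ else default, fun _ p => p)
  | n + 1 => (attach (stage n).1 (stage n).2, sweep (attach (stage n).1 (stage n).2) (stage n).2)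

/-- The characteristic map of the cell `(1, c, 1)` on the closed cube. -/
noncomputable def χ {n : ℕ} : S.V n → (Fin n → ℝ) → S.Pt := (S.stage n).1

/-- The contraction of `S.Y n`, at time `τ` from `0` to `1`. Its values outside `S.Y n` have no
significance. -/
noncomputable def h (n : ℕ) : ℝ → S.Pt → S.Pt := (S.stage n).2

theorem χ_of_lt {n : ℕ} (c : S.V n) {x : Fin n → ℝ} (hx : ‖x‖ < 1) :
    S.χ c x = ⟨n, (1, c, 1), x, hx⟩ := by
  cases n with
  | zero => exact dif_pos hx
  | succ n => exact dif_pos hx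

variable {S}

section

variable {n : ℕ} {d : S.V (n + 1)} {x : Fin (n + 1) → ℝ}

theorem χ_side (hx : 1 ≤ ‖fun i : Fin n => x i.succ‖) : S.χ d x =
    S.h n ((x 0 + 1) / 2) ((S.χ (S.tail d) fun i => x i.succ).tr (S.head d) 1) := by
  have h : ¬ ‖x‖ < 1 := fun h => not_lt.2 hx ((norm_lt_iff zero_lt_one).1 h).2
  exact (dif_neg h).trans (if_neg (not_lt.2 hx))

theorem χ_bottom' (hx : ‖fun i : Fin n => x i.succ‖ < 1) (hx0 : x 0 = -1) :
    S.χ d x = (S.χ (S.tail d) fun i => x i.succ).tr (S.head d) 1 := by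
  have h : ¬ ‖x‖ < 1 := fun h => by
    have := ((norm_lt_iff zero_lt_one).1 h).1
    rw [hx0] at this
    simp at this
  exact (dif_neg h).trans ((if_pos hx).trans (if_pos (by rw [hx0]; norm_num)))

theorem χ_top' (hx : ‖fun i : Fin n => x i.succ‖ < 1) (hx0 : x 0 = 1) :
    S.χ d x = S.crit (S.val d) := by
  have h : ¬ ‖x‖ < 1 := fun h => by
    have := ((norm_lt_iff zero_lt_one).1 h).1
    rw [hx0] at this
    simp at this
  exact (dif_neg h).trans ((if_pos hx).trans (if_neg (by rw [hx0]; norm_num)))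

theorem χ_of_inBox {p : S.Pt} {m m' : M} (hp : S.InBox p m d m' x) : (S.χ d x).tr m m' = p := by
  obtain ⟨hd, ⟨h, h0, rfl⟩ | ⟨h, rfl⟩⟩ := hp
  · rw [χ_bottom' h h0, χ_of_lt _ _ h]
    simp [Pt.tr]
  · rw [χ_of_lt _ _ h]
    simp [Pt.tr]

theorem inBox_of_gau_ne {m : M} (m' : M) (hd : S.Col m d) (hx : ‖x‖ ≤ 1) (hg : gau x ≠ 1) :
    S.InBox ((S.χ d x).tr m m') m d m' x := by
  rcases (gau_eq_or hx).resolve_left hg with ⟨h0, h⟩ | h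
  · refine ⟨hd, Or.inl ⟨h, h0, ?_⟩⟩
    rw [χ_bottom' h h0, χ_of_lt _ _ h]
    simp [Pt.tr]
  · refine ⟨hd, Or.inr ⟨h, ?_⟩⟩
    rw [χ_of_lt _ _ h]
    simp [Pt.tr]

theorem h_zero (n : ℕ) (p : S.Pt) : S.h n 0 p = p := by
  induction n with
  | zero => rfl
  | succ n ih =>
    obtain ⟨h₁, h₂, -⟩ := (exists_sweep (S.χ (n := n + 1)) (S.h n)).choose_spec
    by_cases hp : ∃ m d m' z, S.InBox (n := n) p m d m' z
    · obtain ⟨m, d, m', z, hp⟩ := hp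
      refine (h₂ 0 p m d m' z hp (by simpa using gau_le hp.norm_le)).trans ?_
      rw [flow_zero hp.norm_le, χ_of_inBox hp]
    · exact (h₁ 0 p fun m d m' z hz => hp ⟨m, d, m', z, hz⟩).trans ih

/-- The contraction does not depend on the stage. -/
theorem h_succ_of_mem {p : S.Pt} (hp : p ∈ S.Y n) (τ : ℝ) : S.h (n + 1) τ p = S.h n τ p :=
  (exists_sweep (S.χ (n := n + 1)) (S.h n)).choose_spec.1 τ p fun _ _ _ _ h => h.not_mem_Y hp

/-- The contraction on a closed cell that is collapsible. -/
theorem h_succ_χ {m : M} (m' : M) (hd : S.Col m d) (hx : ‖x‖ ≤ 1) {τ : ℝ} (hτ : 0 ≤ τ) :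
    S.h (n + 1) τ ((S.χ d x).tr m m') =
      S.h (n + 1) (left τ x) ((S.χ d (flow τ x)).tr m m') := by
  by_cases hg : gau x = 1
  · rw [left_of_gau hg hτ, flow_of_gau hg hτ]
  · have hp := inBox_of_gau_ne m' hd hx hg
    obtain ⟨-, h₂, h₃⟩ := (exists_sweep (S.χ (n := n + 1)) (S.h n)).choose_spec
    rcases le_or_gt (gau x + τ) 1 with h | h
    · rw [left_of_le h, h_zero]
      exact h₂ τ _ m d m' x hp h
    · exact h₃ τ _ m d m' x hp h

end

/-! #### The points that are reached -/

/-- The cell that carries the point `p` is bounded by the cell `e`. -/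
def ptLE {k : ℕ} (p : S.Pt) (e : M × S.V k × M) : Prop := S.le p.cell e

theorem ptLE.tr {k : ℕ} {p : S.Pt} {c : S.V k} (hp : ptLE p (1, c, 1)) (m m' : M) :
    ptLE (p.tr m m') (m, c, m') := S.le_mul m m' hp

/-- The characteristic map of a cell takes its values in the cells that are bounded by this cell,
and maps the boundary of the cube to cells of smaller dimension. -/
def ChiGood (S : CollapsingScheme M) (n : ℕ) : Prop := ∀ (c : S.V n) (x : Fin n → ℝ), ‖x‖ ≤ 1 →
  ptLE (S.χ c x) (1, c, 1) ∧ (‖x‖ = 1 → (S.χ c x).dim < n)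

/-- The contraction of `S.Y n` stays in `S.Y n`, moves a point only through cells that are bounded
by the cell of the point, ends at the critical point of the component, and commutes with the right
action of `M`. -/
def HGood (S : CollapsingScheme M) (n : ℕ) : Prop := ∀ p ∈ S.Y n, ∀ τ : ℝ, 0 ≤ τ → τ ≤ 1 →
  S.h n τ p ∈ S.Y n ∧ ptLE (S.h n τ p) p.cell ∧ S.h n 1 p = S.crit p.val ∧
    ∀ t, S.h n τ (p.tr 1 t) = (S.h n τ p).tr 1 t

theorem crit_mem_Y (t : M) (n : ℕ) : S.crit t ∈ S.Y n := by
  rcases n.eq_zero_or_pos with rfl | h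
  · exact Or.inr ⟨rfl, (S.col_base 1).2 rfl⟩
  · exact Or.inl h

theorem mem_Y_succ {n : ℕ} {p : S.Pt} (hp : p ∈ S.Y n) : p ∈ S.Y (n + 1) := by
  rcases hp with h | ⟨h, -⟩
  · exact Or.inl (h.trans (Nat.lt_succ_self n))
  · exact Or.inl (h ▸ Nat.lt_succ_self _)

theorem tr_right_mem_Y {n : ℕ} {p : S.Pt} (hp : p ∈ S.Y n) (t : M) : p.tr 1 t ∈ S.Y n := by
  simpa [Y, Pt.tr] using hp

theorem Pt.val_eq_of_ptLE {k : ℕ} {p : S.Pt} {e : M × S.V k × M} (h : ptLE p e) :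
    p.val = e.1 * S.val e.2.1 * e.2.2 := S.val_eq_of_le h

section

variable {n : ℕ} (hχ : S.ChiGood n) (hh : S.HGood n)
include hχ hh

/-- The upper faces of a cell consist of points of `S.Y n`. -/
theorem χ_mem_Y (d : S.V (n + 1)) {w : Fin (n + 1) → ℝ} (hw : ‖w‖ ≤ 1) (hg : gau w = 1) :
    S.χ d w ∈ S.Y n := by
  obtain ⟨h₁, h₂⟩ := (norm_le_iff zero_le_one).1 hw
  rw [abs_le] at h₁
  rcases h₂.lt_or_eq with h₂ | h₂
  · have h0 : w 0 = 1 := by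
      rcases max_choice ‖fun i : Fin n => w i.succ‖ ((w 0 + 3) / 4) with h | h
      · rw [gau, h] at hg
        exact absurd hg h₂.ne
      · rw [gau, h] at hg
        linarith
    rw [χ_top' h₂ h0]
    exact crit_mem_Y _ _
  · rw [χ_side h₂.ge]
    exact (hh (Pt.tr (S.head d) 1 (S.χ (S.tail d) fun i => w i.succ))
      (Or.inl ((hχ _ _ h₂.le).2 h₂)) ((w 0 + 1) / 2) (by linarith) (by linarith)).1

theorem χ_succ_good : S.ChiGood (n + 1) := by
  intro d x hx
  by_cases hlt : ‖x‖ < 1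
  · rw [χ_of_lt _ _ hlt]
    exact ⟨S.le_refl _, fun h => absurd h hlt.ne⟩
  obtain ⟨h₁, h₂⟩ := (norm_le_iff zero_le_one).1 hx
  rw [abs_le] at h₁
  have hle : S.le (S.head d, S.tail d, 1) (1, d, 1) := by simpa using S.le_tail 1 1 d
  rcases h₂.lt_or_eq with h₂ | h₂
  · have h0 : |x 0| = 1 := by
      rw [norm_lt_iff zero_lt_one, not_and] at hlt
      exact le_antisymm (abs_le.2 h₁) (not_lt.1 fun h => hlt h h₂)
    rcases eq_or_eq_neg_of_abs_eq h0 with h0 | h0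
    · rw [χ_top' h₂ h0]
      refine ⟨?_, fun _ => Nat.succ_pos n⟩
      have := S.le_base 1 1 d
      simpa [ptLE, crit] using this
    · rw [χ_bottom' h₂ h0, χ_of_lt _ _ h₂]
      refine ⟨?_, fun _ => Nat.lt_succ_self n⟩
      simpa [ptLE, Pt.tr] using hle
  · rw [χ_side h₂.ge]
    have h₃ := hχ (S.tail d) _ h₂.le
    have h₄ := hh ((S.χ (S.tail d) fun i => x i.succ).tr (S.head d) 1) (Or.inl (h₃.2 h₂))
      ((x 0 + 1) / 2) (by linarith) (by linarith)
    refine ⟨S.le_trans (S.le_trans h₄.2.1 (h₃.1.tr _ _)) hle, fun _ => ?_⟩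
    rcases h₄.1 with h | ⟨h, -⟩
    · exact h.trans (Nat.lt_succ_self n)
    · exact h.trans_lt (Nat.lt_succ_self n)

/-- The points of the upper faces of a collapsible cell `(m, d, m')` belong to `S.Y n`, or to a box
that comes earlier. -/
theorem mem_Y_or_lt {m : M} (m' : M) {d : S.V (n + 1)} (hd : S.Col m d) {w : Fin (n + 1) → ℝ}
    (hw : ‖w‖ ≤ 1) (hg : gau w = 1) : (S.χ d w).tr m m' ∈ S.Y n ∨
      ∃ (m₁ : M) (d₁ : S.V (n + 1)) (m₁' : M) (z : Fin (n + 1) → ℝ),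
        S.InBox ((S.χ d w).tr m m') m₁ d₁ m₁' z ∧
        S.lt (m₁ * S.head d₁, S.tail d₁, m₁') (m * S.head d, S.tail d, m') := by
  have h := χ_mem_Y hχ hh d hw hg
  have hle : S.le (S.χ d w).cell (1, d, 1) := ((χ_succ_good hχ hh) d w hw).1
  generalize S.χ d w = p at h hle ⊢
  by_cases hp : p.tr m m' ∈ S.Y n
  · exact Or.inl hp
  · right
    obtain ⟨k, ⟨x, c, y⟩, b, hb⟩ := p
    rcases h with h | ⟨h, hc⟩
    · exact absurd (Or.inl h) hp
    · obtain rfl : k = n := h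
      have hcol : ¬ S.Col (m * x) c := fun h => hp (Or.inr ⟨rfl, h⟩)
      obtain ⟨m₁, d₁, hd₁, e₁, e₂⟩ := S.exists_lift hcol
      refine ⟨m₁, d₁, y * m', Fin.cons (-1) b, ⟨hd₁, Or.inl ⟨by simpa using hb, by simp, ?_⟩⟩, ?_⟩
      · simp only [Pt.tr, e₁, e₂, Fin.cons_succ]
      · rw [e₁, e₂]
        exact S.lt_of_le m' hd hle hc

/-- Induction over the boxes in the order in which they are collapsed. -/
theorem box_induction {p : S.Pt → Prop} (hY : ∀ q ∈ S.Y n, p q)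
    (hbox : ∀ (m : M) (d : S.V (n + 1)) (m' : M), S.Col m d →
      (∀ w : Fin (n + 1) → ℝ, ‖w‖ ≤ 1 → gau w = 1 → p ((S.χ d w).tr m m')) →
        ∀ z : Fin (n + 1) → ℝ, ‖z‖ ≤ 1 → p ((S.χ d z).tr m m')) :
    ∀ q ∈ S.Y (n + 1), p q := by
  have key : ∀ (e : M × S.V n × M) (m : M) (d : S.V (n + 1)) (m' : M), S.Col m d →
      e = (m * S.head d, S.tail d, m') →
      ∀ z : Fin (n + 1) → ℝ, ‖z‖ ≤ 1 → p ((S.χ d z).tr m m') := by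
    intro e
    induction e using (S.lt_wf n).induction with
    | _ e ih =>
      rintro m d m' hd rfl
      refine hbox m d m' hd fun w hw hg => ?_
      rcases mem_Y_or_lt hχ hh m' hd hw hg with h | ⟨m₁, d₁, m₁', z, hin, hlt⟩
      · exact hY _ h
      · rw [← χ_of_inBox hin]
        exact ih _ hlt _ _ _ hin.1 rfl _ hin.norm_le
  intro q hq
  by_cases hq' : q ∈ S.Y n
  · exact hY q hq'
  · obtain ⟨m, d, m', z, hz⟩ := exists_inBox hq hq'
    rw [← χ_of_inBox hz]
    exact key _ m d m' hz.1 rfl z hz.norm_le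

theorem χ_tr_mem_Y_succ {m : M} (m' : M) {d : S.V (n + 1)} (hd : S.Col m d)
    {z : Fin (n + 1) → ℝ} (hz : ‖z‖ ≤ 1) : (S.χ d z).tr m m' ∈ S.Y (n + 1) := by
  by_cases h : ‖z‖ < 1
  · rw [χ_of_lt _ _ h]
    exact Or.inr ⟨rfl, by simpa [Pt.tr] using hd⟩
  · exact Or.inl ((χ_succ_good hχ hh d z hz).2 (le_antisymm hz (not_lt.1 h)))

theorem h_succ_good : S.HGood (n + 1) := by
  refine box_induction hχ hh (fun q hq τ h0 h1 => ?_) fun m d m' hd ih z hz τ h0 h1 => ?_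
  · obtain ⟨h₁, h₂, h₃, h₄⟩ := hh q hq τ h0 h1
    refine ⟨?_, ?_, ?_, fun t => ?_⟩
    · rw [h_succ_of_mem hq]; exact mem_Y_succ h₁
    · rw [h_succ_of_mem hq]; exact h₂
    · rw [h_succ_of_mem hq]; exact h₃
    · rw [h_succ_of_mem hq, h_succ_of_mem (tr_right_mem_Y hq t)]; exact h₄ t
  · have hval : ∀ w : Fin (n + 1) → ℝ, ‖w‖ ≤ 1 → ((S.χ d w).tr m m').val = m * S.val d * m' :=
      fun w hw => Pt.val_eq_of_ptLE ((χ_succ_good hχ hh d w hw).1.tr m m')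
    by_cases hg : gau z = 1
    · exact ih z hz hg τ h0 h1
    have hle : S.le (m, d, m') ((S.χ d z).tr m m').cell := by
      obtain ⟨-, ⟨h, -, e⟩ | ⟨h, e⟩⟩ := inBox_of_gau_ne m' hd hz hg
      · rw [e]; exact S.le_of_col m' hd
      · rw [e]; exact S.le_refl _
    have hf : ∀ σ : ℝ, 0 ≤ σ → ‖flow σ z‖ ≤ 1 := fun σ hσ => norm_flow_le hz hσ
    have hg' : ∀ σ : ℝ, 0 ≤ σ → 1 ≤ gau z + σ → gau (flow σ z) = 1 := fun σ hσ h => by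
      rw [gau_flow hz hσ, min_eq_right h]
    have hχle : ptLE ((S.χ d (flow τ z)).tr m m') ((S.χ d z).tr m m').cell :=
      S.le_trans ((χ_succ_good hχ hh d _ (hf τ h0)).1.tr m m') hle
    refine ⟨?_, ?_, ?_, fun t => ?_⟩
    · rw [h_succ_χ m' hd hz h0]
      rcases le_or_gt (gau z + τ) 1 with h | h
      · rw [left_of_le h, h_zero]
        exact χ_tr_mem_Y_succ hχ hh m' hd (hf τ h0)
      · exact (ih _ (hf τ h0) (hg' τ h0 h.le) _ (left_nonneg hz) (left_le hz h1)).1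
    · rw [h_succ_χ m' hd hz h0]
      rcases le_or_gt (gau z + τ) 1 with h | h
      · rw [left_of_le h, h_zero]
        exact hχle
      · exact S.le_trans
          (ih _ (hf τ h0) (hg' τ h0 h.le) _ (left_nonneg hz) (left_le hz h1)).2.1 hχle
    · have hg1 : 1 ≤ gau z + 1 := by linarith [le_gau hz]
      rw [h_succ_χ m' hd hz zero_le_one, left_one hz,
        (ih _ (hf 1 zero_le_one) (hg' 1 zero_le_one hg1) 1 zero_le_one le_rfl).2.2.1,
        hval _ (hf 1 zero_le_one), hval _ hz]
    · rw [Pt.tr_tr, one_mul, h_succ_χ _ hd hz h0, h_succ_χ m' hd hz h0]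
      rcases le_or_gt (gau z + τ) 1 with h | h
      · rw [left_of_le h, h_zero, h_zero, Pt.tr_tr, one_mul]
      · rw [← (ih _ (hf τ h0) (hg' τ h0 h.le) _ (left_nonneg hz) (left_le hz h1)).2.2.2 t,
          Pt.tr_tr, one_mul]

end

theorem good (n : ℕ) : S.ChiGood n ∧ S.HGood n := by
  induction n with
  | zero =>
    refine ⟨fun c x hx => ?_, fun p hp τ _ _ => ⟨hp, S.le_refl _, ?_, fun t => rfl⟩⟩
    · have h0 : ‖x‖ = 0 := by rw [Subsingleton.elim x 0, norm_zero]
      rw [χ_of_lt _ _ (h0.trans_lt zero_lt_one)]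
      exact ⟨S.le_refl _, fun h => by rw [h0] at h; exact absurd h zero_ne_one⟩
    · rcases hp with h | ⟨h, hc⟩
      · exact absurd h (Nat.not_lt_zero _)
      · exact eq_crit h hc
  | succ n ih => exact ⟨χ_succ_good ih.1 ih.2, h_succ_good ih.1 ih.2⟩

end CollapsingScheme

/-! ### Continuity of the attaching maps and of the contraction -/

open unitInterval in
theorem continuous_of_continuous_curry {W Z Y : Type*} [TopologicalSpace W] [TopologicalSpace Z]
    [TopologicalSpace Y] {F : Z → C(I, Y)} (hF : Continuous F) {y : W → Z} (hy : Continuous y) :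
    Continuous fun p : I × W => F (y p.2) p.1 := by
  fun_prop

namespace CollapsingScheme

open Cube unitInterval

/-- The closed cube. -/
abbrev Q (n : ℕ) : Type := Metric.closedBall (0 : Fin n → ℝ) 1

/-- The boundary of the cube. -/
abbrev Sph (n : ℕ) : Type := Metric.sphere (0 : Fin n → ℝ) 1

theorem norm_le_of_Q {n : ℕ} (x : Q n) : ‖x.1‖ ≤ 1 := mem_closedBall_zero_iff.1 x.2

theorem norm_of_Sph {n : ℕ} (x : Sph n) : ‖x.1‖ = 1 := mem_sphere_zero_iff_norm.1 x.2

variable {M : Type u} [Monoid M] (S : CollapsingScheme M)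

/-- The characteristic map of a cell. -/
noncomputable def char {n : ℕ} (e : M × S.V n × M) (x : Q n) : S.Pt :=
  (S.χ e.2.1 x).tr e.1 e.2.2

/-- The set of all points, with the finest topology for which the characteristic maps of the cells
of dimension less than `k` are continuous. -/
def St (_ : ℕ) : Type u := S.Pt

/-- A point, regarded as a point of the space that is made of the cells of dimension less than
`k`. -/
def toSt (k : ℕ) (p : S.Pt) : S.St k := p

noncomputable instance (k : ℕ) : TopologicalSpace (S.St k) :=
  ⨆ (n : ℕ) (_ : n < k) (e : M × S.V n × M),
    TopologicalSpace.coinduced (fun x : Q n => S.toSt k (S.char e x)) inferInstance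

variable {S}

theorem isClosed_St {k : ℕ} {T : Set (S.St k)} : IsClosed T ↔
    ∀ n < k, ∀ e : M × S.V n × M, IsClosed {x : Q n | S.toSt k (S.char e x) ∈ T} := by
  refine isClosed_iSup_iff.trans (forall_congr' fun n => ?_)
  refine isClosed_iSup_iff.trans (forall_congr' fun hn => ?_)
  refine isClosed_iSup_iff.trans (forall_congr' fun e => ?_)
  exact isClosed_coinduced

theorem continuous_char {n k : ℕ} (h : n < k) (e : M × S.V n × M) :
    Continuous fun x : Q n => S.toSt k (S.char e x) :=
  continuous_iff_isClosed.2 fun _ hT => isClosed_St.1 hT n h e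

theorem continuous_St_id {k l : ℕ} (h : k ≤ l) : Continuous fun p : S.St k => S.toSt l p :=
  continuous_iff_isClosed.2 fun _ hT =>
    isClosed_St.2 fun n hn e => isClosed_St.1 hT n (hn.trans_le h) e

theorem char_tr {n : ℕ} (m m' : M) (e : M × S.V n × M) (x : Q n) :
    (S.char e x).tr m m' = S.char (m * e.1, e.2.1, e.2.2 * m') x := Pt.tr_tr _ _ _ _ _

theorem continuous_tr {k : ℕ} (m m' : M) :
    Continuous fun p : S.St k => S.toSt k (Pt.tr m m' p) :=
  continuous_iff_isClosed.2 fun T hT => isClosed_St.2 fun n hn e => by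
    have := isClosed_St.1 hT n hn (m * e.1, e.2.1, e.2.2 * m')
    simp only [← char_tr] at this
    exact this

theorem Pt.eq_char (p : S.Pt) :
    p = S.char p.cell ⟨p.pos, mem_closedBall_zero_iff.2 p.norm_lt.le⟩ := by
  rw [char, χ_of_lt _ _ p.norm_lt]
  simp [Pt.tr]

theorem char_of_lt {n : ℕ} (e : M × S.V n × M) {x : Q n} (hx : ‖x.1‖ < 1) :
    S.char e x = ⟨n, e, x, hx⟩ := by
  rw [char, χ_of_lt _ _ hx]
  simp [Pt.tr]

theorem dim_char_lt {n : ℕ} (e : M × S.V n × M) {x : Q n} (hx : ‖x.1‖ = 1) :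
    (S.char e x).dim < n := ((good n).1 e.2.1 x hx.le).2 hx

theorem char_cases {n : ℕ} (e : M × S.V n × M) (x : Q n) :
    (‖x.1‖ = 1 ∧ (S.char e x).dim < n) ∨ ∃ hx : ‖x.1‖ < 1, S.char e x = ⟨n, e, x, hx⟩ := by
  rcases (norm_le_of_Q x).lt_or_eq with h | h
  · exact Or.inr ⟨h, char_of_lt e h⟩
  · exact Or.inl ⟨h, dim_char_lt e h⟩

theorem dim_char_le {n : ℕ} (e : M × S.V n × M) (x : Q n) : (S.char e x).dim ≤ n := by
  rcases char_cases e x with ⟨-, h⟩ | ⟨h, e⟩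
  · exact h.le
  · rw [e]

variable (S)

/-- The attaching maps of the `n`-cells are continuous for the topology given by the cells of
smaller dimension. -/
def Att (n : ℕ) : Prop := ∀ c : S.V n, Continuous fun x : Sph n => S.toSt n (S.χ c x)

/-- The contraction is continuous on the closed cells of `S.Y n`. -/
def HCont (n : ℕ) : Prop :=
  (∀ k < n, ∀ e : M × S.V k × M,
    Continuous fun p : I × Q k => S.toSt (n + 1) (S.h n p.1 (S.char e p.2))) ∧
  ∀ e : M × S.V n × M, S.Col e.1 e.2.1 →
    Continuous fun p : I × Q n => S.toSt (n + 1) (S.h n p.1 (S.char e p.2))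

variable {S}

/-- A homotopy on a subcomplex `Z` of dimension at most `n` is continuous if it is continuous on
closed cells. The subcomplex consists of all cells of dimension less than `n` and of those
`n`-cells that satisfy `Zc`. The exponential law makes it enough to see that the adjoint map to the
path space is continuous. -/
theorem Att.continuous_homotopy {n : ℕ} (hA : S.Att n) {Y W : Type*} [TopologicalSpace Y]
    [TopologicalSpace W] {G : I → S.Pt → Y} {Zc : M × S.V n × M → Prop}
    (hG : ∀ k < n, ∀ e : M × S.V k × M,
      Continuous fun p : I × Q k => G p.1 (S.char e p.2))
    (hG' : ∀ e, Zc e → Continuous fun p : I × Q n => G p.1 (S.char e p.2))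
    {y : W → S.Pt} (hy : Continuous fun w => S.toSt (n + 1) (y w))
    (hZ : ∀ w, (y w).dim < n ∨ ∃ e x hx, Zc e ∧ y w = ⟨n, e, x, hx⟩) :
    Continuous fun p : I × W => G p.1 (y p.2) := by
  let Z : Set (S.St (n + 1)) := {p | Pt.dim p < n ∨ ∃ e x hx, Zc e ∧ p = (⟨n, e, x, hx⟩ : S.Pt)}
  have hpt : ∀ p ∈ Z, Continuous fun τ => G τ p := by
    rintro p (h | ⟨e, x, hx, he, rfl⟩)
    · rw [Pt.eq_char p]
      exact (hG _ h _).comp (by fun_prop : Continuous fun τ : I => (τ, _))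
    · have := char_of_lt e (x := ⟨x, mem_closedBall_zero_iff.2 hx.le⟩) hx
      rw [← this]
      exact (hG' e he).comp (by fun_prop : Continuous fun τ : I => (τ, _))
  let F : Z → C(I, Y) := fun p => ⟨fun τ => G τ p.1, hpt p.1 p.2⟩
  have hcell : ∀ {k : ℕ} {e : M × S.V k × M} (hm : ∀ x, S.char e x ∈ Z),
      (Continuous fun p : I × Q k => G p.1 (S.char e p.2)) →
      Continuous fun x => F ⟨S.char e x, hm x⟩ := by
    intro k e hm h
    refine ContinuousMap.continuous_of_continuous_uncurry _ ?_
    exact h.comp continuous_swap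
  have hF : Continuous F := by
    refine continuous_iff_isClosed.2 fun C hC => ?_
    let T : Set S.Pt := {p | ∃ h : p ∈ Z, F ⟨p, h⟩ ∈ C}
    have hmem : ∀ {k : ℕ} {e : M × S.V k × M} (hm : ∀ x, S.char e x ∈ Z),
        (Continuous fun p : I × Q k => G p.1 (S.char e p.2)) →
        IsClosed {x : Q k | S.char e x ∈ T} := by
      intro k e hm h
      convert hC.preimage (hcell hm h) using 1
      ext x
      exact ⟨fun ⟨_, h⟩ => h, fun h => ⟨hm x, h⟩⟩
    have hlow : ∀ k < n, ∀ e : M × S.V k × M, IsClosed {x : Q k | S.char e x ∈ T} :=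
      fun k hk e => hmem (fun x => Or.inl ((dim_char_le e x).trans_lt hk)) (hG k hk e)
    have hT : IsClosed (X := S.St (n + 1)) T := by
      refine isClosed_St.2 fun k hk e => ?_
      rcases (Nat.lt_succ_iff.1 hk).lt_or_eq with hk | rfl
      · exact hlow k hk e
      by_cases he : Zc e
      · refine hmem (fun x => ?_) (hG' e he)
        rcases char_cases e x with ⟨-, h⟩ | ⟨hx, h⟩
        · exact Or.inl h
        · exact Or.inr ⟨e, x, hx, he, h⟩
      · have hT' : IsClosed (X := S.St k) T := isClosed_St.2 hlow
        have hcl : IsClosed {x : Sph k | S.char e ⟨x.1, Metric.sphere_subset_closedBall x.2⟩ ∈ T} :=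
          hT'.preimage ((continuous_tr e.1 e.2.2).comp (hA e.2.1))
        have hemb : Topology.IsClosedEmbedding
            (fun x : Sph k => (⟨x.1, Metric.sphere_subset_closedBall x.2⟩ : Q k)) :=
          ((continuous_subtype_val.subtype_mk _).isClosedEmbedding fun a b h =>
            Subtype.ext (congrArg (fun x : Q k => x.1) h))
        convert hemb.isClosedMap _ hcl using 1
        ext x
        constructor
        · intro hx
          rcases char_cases e x with ⟨h, -⟩ | ⟨h, h'⟩
          · exact ⟨⟨x.1, mem_sphere_zero_iff_norm.2 h⟩, hx, rfl⟩
          · obtain ⟨hx, -⟩ := hx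
            rw [h'] at hx
            rcases hx with hx | ⟨e', x', hx', he', heq⟩
            · exact absurd hx (lt_irrefl _)
            · obtain ⟨-, h₁, -⟩ := Pt.mk.inj heq
              exact absurd (eq_of_heq h₁ ▸ he') he
        · rintro ⟨y, hy, rfl⟩
          exact hy
    convert hT.preimage (continuous_subtype_val (p := (· ∈ Z))) using 1
    ext p
    exact ⟨fun h => ⟨p.2, h⟩, fun ⟨_, h⟩ => h⟩
  exact continuous_of_continuous_curry hF (hy.subtype_mk hZ)

theorem χ_bottom {n : ℕ} (d : S.V (n + 1)) {x : Fin (n + 1) → ℝ} (hx : ‖x‖ ≤ 1) (h0 : x 0 = -1) :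
    S.χ d x = (S.χ (S.tail d) fun i => x i.succ).tr (S.head d) 1 := by
  rcases ((norm_le_iff zero_le_one).1 hx).2.lt_or_eq with h | h
  · exact χ_bottom' h h0
  · rw [χ_side h.ge, h0, neg_add_cancel, zero_div, h_zero]

theorem χ_top {n : ℕ} (d : S.V (n + 1)) {x : Fin (n + 1) → ℝ} (hx : ‖x‖ ≤ 1) (h0 : x 0 = 1) :
    S.χ d x = S.crit (S.val d) := by
  rcases ((norm_le_iff zero_le_one).1 hx).2.lt_or_eq with h | h
  · exact χ_top' h h0
  · have hχ := (good n).1 (S.tail d) _ h.le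
    rw [χ_side h.ge, h0, one_add_one_eq_two, div_self two_ne_zero,
      ((good n).2 (Pt.tr _ _ _) (Or.inl (hχ.2 h)) 1 zero_le_one le_rfl).2.2.1,
      Pt.val_eq_of_ptLE (hχ.1.tr _ _), mul_one, S.val_succ]

/-- The boundary of the cube is the union of the top face, the bottom face and the sides, which are
all closed; on the sides the attaching map is the contraction applied to an attaching map. -/
theorem att_succ {n : ℕ} (hA : S.Att n) (hH : S.HCont n) : S.Att (n + 1) := by
  intro d
  have hb : Continuous fun x : Sph (n + 1) => fun i : Fin n => x.1 i.succ :=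
    continuous_pi fun i => (continuous_apply i.succ).comp continuous_subtype_val
  have h0 : Continuous fun x : Sph (n + 1) => x.1 0 :=
    (continuous_apply 0).comp continuous_subtype_val
  have hn := fun x : Sph (n + 1) => (norm_le_iff zero_le_one).1 (norm_of_Sph x).le
  have hside : ContinuousOn (fun x : Sph (n + 1) => S.toSt (n + 1) (S.χ d x))
      {x | ‖fun i : Fin n => x.1 i.succ‖ = 1} := by
    have hy : Continuous fun w : Sph n => S.toSt (n + 1) (Pt.tr (S.head d) 1 (S.χ (S.tail d) w)) :=
      (continuous_St_id n.le_succ).comp ((continuous_tr _ _).comp (hA (S.tail d)))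
    have key := hA.continuous_homotopy (G := fun τ p => S.toSt (n + 1) (S.h n τ p))
      (Zc := fun _ => False) hH.1 (fun _ h => h.elim) hy fun w =>
        Or.inl (((good n).1 (S.tail d) w (norm_of_Sph w).le).2 (norm_of_Sph w))
    rw [continuousOn_iff_continuous_domRestrict]
    let g : {x : Sph (n + 1) | ‖fun i : Fin n => x.1 i.succ‖ = 1} → I × Sph n := fun x =>
      (⟨(x.1.1 0 + 1) / 2, by
        have := abs_le.1 (hn x.1).1
        constructor <;> linarith⟩, ⟨fun i => x.1.1 i.succ, mem_sphere_zero_iff_norm.2 x.2⟩)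
    have hg : Continuous g := by
      refine Continuous.prodMk (Continuous.subtype_mk ?_ _) (Continuous.subtype_mk ?_ _)
      · exact ((h0.comp continuous_subtype_val).add continuous_const).div_const 2
      · exact hb.comp continuous_subtype_val
    convert key.comp hg using 1
    funext x
    exact χ_side x.2.ge
  have hbot : ContinuousOn (fun x : Sph (n + 1) => S.toSt (n + 1) (S.χ d x)) {x | x.1 0 = -1} := by
    rw [continuousOn_iff_continuous_domRestrict]
    have key := (continuous_tr (S.head d) 1).comp
      (continuous_char n.lt_succ_self (1, S.tail d, (1 : M)))
    let g : {x : Sph (n + 1) | x.1 0 = -1} → Q n := fun x =>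
      ⟨fun i => x.1.1 i.succ, mem_closedBall_zero_iff.2 (hn x.1).2⟩
    have hg : Continuous g := Continuous.subtype_mk (hb.comp continuous_subtype_val) _
    convert key.comp hg using 1
    funext x
    refine (χ_bottom d (norm_of_Sph x.1).le x.2).trans ?_
    exact congrArg (Pt.tr (S.head d) 1) (Pt.tr_one _).symm
  have htop : ContinuousOn (fun x : Sph (n + 1) => S.toSt (n + 1) (S.χ d x)) {x | x.1 0 = 1} :=
    (continuousOn_const (c := S.toSt (n + 1) (S.crit (S.val d)))).congr fun x hx =>
      χ_top d (norm_of_Sph x).le hx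
  have hc₁ : IsClosed {x : Sph (n + 1) | ‖fun i : Fin n => x.1 i.succ‖ = 1} :=
    isClosed_eq hb.norm continuous_const
  have hc₂ : IsClosed {x : Sph (n + 1) | x.1 0 = -1} := isClosed_eq h0 continuous_const
  have hc₃ : IsClosed {x : Sph (n + 1) | x.1 0 = 1} := isClosed_eq h0 continuous_const
  rw [← continuousOn_univ]
  refine ((hside.union_of_isClosed hbot hc₁ hc₂).union_of_isClosed htop
    (hc₁.union hc₂) hc₃).mono fun x _ => ?_
  by_contra hx
  simp only [Set.mem_union, Set.mem_ofPred_eq, not_or] at hx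
  refine (norm_of_Sph x).not_lt ((norm_lt_iff zero_lt_one).2 ⟨?_, (hn x).2.lt_of_ne hx.1.1⟩)
  refine (hn x).1.lt_of_ne fun h => ?_
  rcases eq_or_eq_neg_of_abs_eq h with h | h
  exacts [hx.2 h, hx.1.2 h]

end CollapsingScheme

namespace CollapsingScheme

open Cube unitInterval

variable {M : Type u} [Monoid M] {S : CollapsingScheme M}

theorem char_mem_Y {n : ℕ} {e : M × S.V n × M} (he : S.Col e.1 e.2.1) (x : Q n) :
    S.char e x ∈ S.Y n := by
  rcases char_cases e x with ⟨-, h⟩ | ⟨hx, h⟩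
  · exact Or.inl h
  · rw [h]
    exact Or.inr ⟨rfl, he⟩

/-- A redundant cell is the bottom face of its partner. -/
theorem char_redundant {n : ℕ} (m : M) (d : S.V (n + 1)) (m' : M) (x : Q n) :
    S.char (m * S.head d, S.tail d, m') x = S.char (m, d, m') ⟨Fin.cons (-1) x.1,
      mem_closedBall_zero_iff.2 (norm_cons (norm_le_of_Q x)).le⟩ := by
  rw [char, char, χ_bottom d (norm_cons (norm_le_of_Q x)).le (by simp), Pt.tr_tr]
  simp

theorem continuous_h_succ_of_mem {n k : ℕ} {e : M × S.V k × M} (he : ∀ x, S.char e x ∈ S.Y n)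
    (h : Continuous fun p : I × Q k => S.toSt (n + 1) (S.h n p.1 (S.char e p.2))) :
    Continuous fun p : I × Q k => S.toSt (n + 2) (S.h (n + 1) p.1 (S.char e p.2)) := by
  refine ((continuous_St_id (Nat.le_succ (n + 1))).comp h).congr fun p => ?_
  rw [h_succ_of_mem (he _)]
  rfl

theorem continuous_h_redundant {n : ℕ} {m : M} {d : S.V (n + 1)} {m' : M}
    (h : Continuous fun p : I × Q (n + 1) =>
      S.toSt (n + 2) (S.h (n + 1) p.1 (S.char (m, d, m') p.2))) :
    Continuous fun p : I × Q n =>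
      S.toSt (n + 2) (S.h (n + 1) p.1 (S.char (m * S.head d, S.tail d, m') p.2)) := by
  refine (h.comp (g := fun p : I × Q (n + 1) => _) (f := fun p : I × Q n =>
    (p.1, ⟨Fin.cons (-1) p.2.1, mem_closedBall_zero_iff.2 (norm_cons (norm_le_of_Q p.2)).le⟩))
    ?_).congr fun p => ?_
  · refine continuous_fst.prodMk (Continuous.subtype_mk (continuous_pi fun i => ?_) _)
    refine Fin.cases ?_ (fun i => ?_) i
    · simpa using continuous_const
    · simp only [Fin.cons_succ]
      exact (continuous_apply i).comp (continuous_subtype_val.comp continuous_snd)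
  · simp only [Function.comp_apply, char_redundant]

/-- The contraction is continuous on a closed collapsible cell `(m, d, m')`, if it is so on the
boxes that come earlier: until the flow leaves the cell, it is given by the flow, and afterwards by
the contraction of the exit point. -/
theorem continuous_h_box {n : ℕ} (hA : S.Att n) (hA' : S.Att (n + 1)) (hH : S.HCont n)
    {m : M} {d : S.V (n + 1)} (m' : M) (hd : S.Col m d)
    (ih : ∀ m₁ (d₁ : S.V (n + 1)) m₁', S.Col m₁ d₁ →
      S.lt (m₁ * S.head d₁, S.tail d₁, m₁') (m * S.head d, S.tail d, m') →
      Continuous fun p : I × Q (n + 1) =>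
        S.toSt (n + 2) (S.h (n + 1) p.1 (S.char (m₁, d₁, m₁') p.2))) :
    Continuous fun p : I × Q (n + 1) =>
      S.toSt (n + 2) (S.h (n + 1) p.1 (S.char (m, d, m') p.2)) := by
  have hexit : ∀ z : Q (n + 1), gau (flow 1 z.1) = 1 := fun z => by
    rw [gau_flow (norm_le_of_Q z) zero_le_one, min_eq_right]
    linarith [le_gau (norm_le_of_Q z)]
  let ex : Q (n + 1) → Sph (n + 1) := fun z => ⟨flow 1 z.1, mem_sphere_zero_iff_norm.2
    (norm_of_gau (norm_flow_le (norm_le_of_Q z) zero_le_one) (hexit z))⟩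
  have hex : Continuous ex :=
    (continuous_flow.comp (continuous_const.prodMk continuous_id)).subtype_mk _
  have hy : Continuous fun z => S.toSt (n + 1) ((S.χ d (ex z).1).tr m m') :=
    (continuous_tr m m').comp ((hA' d).comp hex)
  have key := hA.continuous_homotopy (G := fun τ p => S.toSt (n + 2) (S.h (n + 1) τ p))
    (Zc := fun e => S.Col e.1 e.2.1 ∨ S.lt e (m * S.head d, S.tail d, m'))
    (fun k hk e =>
      continuous_h_succ_of_mem (fun x => Or.inl ((dim_char_le e x).trans_lt hk)) (hH.1 k hk e))
    (fun e he => by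
      by_cases hc : S.Col e.1 e.2.1
      · exact continuous_h_succ_of_mem (char_mem_Y hc) (hH.2 e hc)
      · obtain ⟨m₀, c, m₁'⟩ := e
        obtain ⟨m₁, d₁, hd₁, rfl, rfl⟩ := S.exists_lift hc
        exact continuous_h_redundant (ih m₁ d₁ m₁' hd₁ (he.resolve_left hc)))
    hy
    (fun z => by
      rcases mem_Y_or_lt (good n).1 (good n).2 m' hd (norm_of_Sph (ex z)).le (hexit z) with
        (h | ⟨h, hc⟩) | ⟨m₁, d₁, m₁', z₁, hin, hlt⟩
      · exact Or.inl h
      · right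
        generalize Pt.tr m m' (S.χ d (ex z).1) = p at h hc
        obtain ⟨k, e, x, hx⟩ := p
        obtain rfl : k = n := h
        exact ⟨e, x, hx, Or.inl hc, rfl⟩
      · obtain ⟨hd₁, ⟨h, -, e⟩ | ⟨h, e⟩⟩ := hin
        · exact Or.inr ⟨_, _, h, Or.inr hlt, e⟩
        · have := (χ_mem_Y (good n).1 (good n).2 d (norm_of_Sph (ex z)).le (hexit z))
          have e' : (S.χ d (ex z).1).dim = n + 1 := congrArg Pt.dim e
          rcases this with h | ⟨h, -⟩ <;> omega)
  let lf : I × Q (n + 1) → I × Q (n + 1) := fun p =>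
    (⟨left p.1 p.2.1, left_nonneg (norm_le_of_Q p.2), left_le (norm_le_of_Q p.2) p.1.2.2⟩, p.2)
  have hcoe : Continuous fun p : I × Q (n + 1) => (p.1.1, p.2) := by fun_prop
  have hlf : Continuous lf :=
    ((continuous_left.comp hcoe).subtype_mk _).prodMk continuous_snd
  have hin : Continuous fun p : I × Q (n + 1) => S.toSt (n + 2) (S.char (m, d, m')
      ⟨flow p.1 p.2.1, mem_closedBall_zero_iff.2 (norm_flow_le (norm_le_of_Q p.2) p.1.2.1)⟩) :=
    (continuous_char (Nat.lt_succ_self (n + 1)) (m, d, m')).comp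
      ((continuous_flow.comp hcoe).subtype_mk _)
  have hg : Continuous fun p : I × Q (n + 1) => gau p.2.1 + (p.1 : ℝ) :=
    (continuous_gau.comp (continuous_subtype_val.comp continuous_snd)).add
      (continuous_subtype_val.comp continuous_fst)
  have hout : ∀ p : I × Q (n + 1), 1 ≤ gau p.2.1 + (p.1 : ℝ) →
      flow p.1 p.2.1 = flow 1 p.2.1 := fun p hp => by
    rw [flow, flow, min_eq_right hp, min_eq_right]
    linarith [le_gau (norm_le_of_Q p.2)]
  refine (Continuous.if_le hin (key.comp hlf) hg (continuous_const (y := (1 : ℝ)))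
    fun p hp => ?_).congr fun p => ?_
  · simp only [Function.comp_apply, lf, ex]
    rw [left_of_le hp.le, h_zero, ← hout p hp.ge]
    rfl
  · have e := h_succ_χ m' hd (norm_le_of_Q p.2) p.1.2.1
    refine Eq.trans ?_ (congrArg (S.toSt (n + 2)) e).symm
    split_ifs with h
    · rw [left_of_le h, h_zero]
      rfl
    · rw [hout p (not_le.1 h).le]
      rfl

/-- The continuity on the closed collapsible cells follows by induction over the order in which the
boxes are collapsed, and a redundant cell is a face of its partner. -/
theorem hCont_succ {n : ℕ} (hA : S.Att n) (hA' : S.Att (n + 1)) (hH : S.HCont n) :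
    S.HCont (n + 1) := by
  have hbox : ∀ (e : M × S.V n × M) (m : M) (d : S.V (n + 1)) (m' : M), S.Col m d →
      e = (m * S.head d, S.tail d, m') → Continuous fun p : I × Q (n + 1) =>
        S.toSt (n + 2) (S.h (n + 1) p.1 (S.char (m, d, m') p.2)) := by
    intro e
    induction e using (S.lt_wf n).induction with
    | _ e ih =>
      rintro m d m' hd rfl
      exact continuous_h_box hA hA' hH m' hd fun m₁ d₁ m₁' hd₁ hlt => ih _ hlt _ _ _ hd₁ rfl
  refine ⟨fun k hk e => ?_, fun e he => hbox _ _ _ _ he rfl⟩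
  rcases (Nat.lt_succ_iff.1 hk).lt_or_eq with hk | rfl
  · exact continuous_h_succ_of_mem (fun x => Or.inl ((dim_char_le e x).trans_lt hk)) (hH.1 k hk e)
  by_cases hc : S.Col e.1 e.2.1
  · exact continuous_h_succ_of_mem (char_mem_Y hc) (hH.2 e hc)
  · obtain ⟨m₀, c, m₁'⟩ := e
    obtain ⟨m₁, d₁, hd₁, rfl, rfl⟩ := S.exists_lift hc
    exact continuous_h_redundant (hbox _ _ _ _ hd₁ rfl)

theorem att_and_hCont (n : ℕ) : S.Att n ∧ S.HCont n := by
  induction n with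
  | zero =>
    refine ⟨fun c => ?_, fun k hk => absurd hk (Nat.not_lt_zero k), fun e _ => ?_⟩
    · have : IsEmpty (Sph 0) := ⟨fun x => by
        have := norm_of_Sph x
        rw [Subsingleton.elim x.1 0, norm_zero] at this
        exact zero_ne_one this⟩
      exact continuous_iff_continuousAt.2 fun x => isEmptyElim x
    · exact (continuous_char zero_lt_one e).comp continuous_snd
  | succ n ih =>
    have h := att_succ ih.1 ih.2
    exact ⟨h, hCont_succ ih.1 h ih.2⟩

end CollapsingScheme

/-! ### The classifying space -/

open unitInterval

/-- A homeomorphism of the ambient spaces that maps the Euclidean unit ball to the cube, and the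
open ball to the open cube. -/
theorem exists_homeomorph_ball_cube (n : ℕ) :
    ∃ g : EuclideanSpace ℝ (Fin n) ≃ₜ (Fin n → ℝ),
      ∀ x, (‖x‖ < 1 ↔ ‖g x‖ < 1) ∧ (‖x‖ ≤ 1 ↔ ‖g x‖ ≤ 1) := by
  let L := EuclideanSpace.equiv (Fin n) ℝ
  let s : Set (EuclideanSpace ℝ (Fin n)) := L ⁻¹' Metric.ball 0 1
  have hs : IsOpen s := Metric.isOpen_ball.preimage L.continuous
  have hcl : closure s = L ⁻¹' Metric.closedBall 0 1 := by
    rw [← closure_ball (0 : Fin n → ℝ) one_ne_zero]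
    exact (L.toHomeomorph.preimage_closure _).symm
  have hconv : Convex ℝ s := (convex_ball (0 : Fin n → ℝ) 1).linear_preimage L.toLinearMap
  have hbdd : Bornology.IsBounded s := by
    have h := L.symm.lipschitz.isBounded_image
      (Metric.isBounded_ball (x := (0 : Fin n → ℝ)) (r := 1))
    refine h.subset fun x hx => ⟨L x, hx, L.symm_apply_apply x⟩
  obtain ⟨f, hf₁, hf₂, -⟩ := exists_homeomorph_image_interior_closure_frontier_eq_unitBall hconv
    ⟨0, by rw [hs.interior_eq]; simp [s]⟩ hbdd
  rw [hs.interior_eq] at hf₁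
  rw [hcl] at hf₂
  refine ⟨f.symm.trans L.toHomeomorph, fun x => ⟨?_, ?_⟩⟩
  · rw [← mem_ball_zero_iff, ← mem_ball_zero_iff, ← hf₁, f.image_eq_preimage_symm]
    rfl
  · rw [← mem_closedBall_zero_iff, ← mem_closedBall_zero_iff, ← hf₂, f.image_eq_preimage_symm]
    rfl

namespace CollapsingScheme

variable {M N T : Type u} [Monoid M] [Monoid N] (S : CollapsingScheme M) (F : Frame M N T)

/-- The `n`-cells of the classifying space. As an `N`-set, it is free on `S.V n`. -/
def CellT (_ : Frame M N T) (n : ℕ) : Type u := M × S.V n × T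

/-- The classifying space: the complex of the points `S.Pt`, where the last component of the cells
is pushed forward from `M` to the `M`-set `T`. -/
structure Space where
  dim : ℕ
  cell : S.CellT F dim
  pos : Fin dim → ℝ
  norm_lt : ‖pos‖ < 1

variable {S F}

instance (n : ℕ) : MulAction N (S.CellT F n) where
  smul a e := (F.proj a * e.1, e.2.1, F.right a e.2.2)
  one_smul e := show (F.proj 1 * e.1, e.2.1, F.right 1 e.2.2) = e by
    rw [map_one, one_mul, F.right_one]
    rfl
  mul_smul a b e := show (F.proj (a * b) * e.1, e.2.1, F.right (a * b) e.2.2) =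
      (F.proj a * (F.proj b * e.1), e.2.1, F.right a (F.right b e.2.2)) by
    rw [map_mul, mul_assoc, F.right_mul]

instance : MulAction N (S.Space F) where
  smul a p := ⟨p.dim, a • p.cell, p.pos, p.norm_lt⟩
  one_smul p := show (⟨p.dim, (1 : N) • p.cell, p.pos, p.norm_lt⟩ : S.Space F) = p by rw [one_smul]
  mul_smul a b p := show (⟨p.dim, (a * b) • p.cell, p.pos, p.norm_lt⟩ : S.Space F) =
    ⟨p.dim, a • b • p.cell, p.pos, p.norm_lt⟩ by rw [mul_smul]

theorem coord_smul {n : ℕ} (m : M) (c : S.V n) (t : T) :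
    F.coord (m, t) • (show S.CellT F n from (1, c, F.pt)) = (m, c, t) := by
  change (F.proj _ * 1, c, F.right _ F.pt) = (m, c, t)
  rw [F.proj_coord, F.right_coord, mul_one]

theorem cellT_projective (n : ℕ) : MonoidTopology.ProjectiveMSet N (S.CellT F n) := by
  intro Q _ f hf
  choose g hg using hf
  refine ⟨⟨fun e => F.coord (e.1, e.2.2) • g (1, e.2.1, F.pt), fun a e => ?_⟩, fun e => ?_⟩
  · change F.coord (F.proj a * e.1, F.right a e.2.2) • g (1, e.2.1, F.pt) =
      a • F.coord (e.1, e.2.2) • g (1, e.2.1, F.pt)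
    rw [smul_smul, F.mul_coord]
  · change f (F.coord (e.1, e.2.2) • g (1, e.2.1, F.pt)) = e
    exact (map_smul f _ _).trans ((congrArg _ (hg _)).trans (coord_smul e.1 e.2.1 e.2.2))

theorem cellT_fg (n : ℕ) : MonoidTopology.FGMSet N (S.CellT F n) := by
  classical
  have := S.finite n
  have := Fintype.ofFinite (S.V n)
  refine ⟨Finset.univ.image fun c : S.V n => ((1, c, F.pt) : S.CellT F n), fun e => ?_⟩
  exact ⟨_, Finset.mem_image_of_mem _ (Finset.mem_univ e.2.1), F.coord (e.1, e.2.2),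
    (coord_smul e.1 e.2.1 e.2.2).symm⟩

/-- The map `(m, c, m') ↦ (m, c, m' t)` on points. -/
def Pt.push (F : Frame M N T) (t : T) (p : S.Pt) : S.Space F :=
  ⟨p.dim, (p.cell.1, p.cell.2.1, F.left p.cell.2.2 t), p.pos, p.norm_lt⟩

theorem Pt.push_tr (t : T) (m : M) (p : S.Pt) :
    (p.tr 1 m).push F t = p.push F (F.left m t) := by
  simp [Pt.push, Pt.tr, F.left_mul]

theorem Pt.smul_push (a : N) (t : T) (p : S.Pt) :
    a • p.push F t = (p.tr (F.proj a) 1).push F (F.right a t) := by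
  change (⟨p.dim, (F.proj a * p.cell.1, p.cell.2.1, F.right a (F.left p.cell.2.2 t)), _, _⟩ :
    S.Space F) = _
  simp [Pt.push, Pt.tr, F.comm]

/-- The characteristic map of a cell, on the closed cube. -/
noncomputable def charT {n : ℕ} (e : S.CellT F n) (x : Q n) : S.Space F :=
  (S.char (e.1, e.2.1, 1) x).push F e.2.2

theorem push_char {n : ℕ} (t : T) (e : M × S.V n × M) (x : Q n) :
    (S.char e x).push F t = charT (F := F) (e.1, e.2.1, F.left e.2.2 t) x := by
  obtain ⟨m, c, m'⟩ := e
  have := char_tr 1 m' (m, c, (1 : M)) x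
  rw [one_mul, one_mul] at this
  rw [← this, Pt.push_tr]
  rfl

theorem smul_charT {n : ℕ} (a : N) (e : S.CellT F n) (x : Q n) :
    a • charT e x = charT (a • e) x := by
  rw [charT, Pt.smul_push, char_tr, mul_one]
  rfl

theorem charT_cases {n : ℕ} (e : S.CellT F n) (x : Q n) :
    (‖x.1‖ = 1 ∧ (charT e x).dim < n) ∨ ∃ hx : ‖x.1‖ < 1, charT e x = ⟨n, e, x, hx⟩ := by
  rcases char_cases (e.1, e.2.1, (1 : M)) x with h | ⟨hx, h⟩
  · exact Or.inl h
  · refine Or.inr ⟨hx, ?_⟩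
    rw [charT, h]
    simp only [Pt.push, F.left_one]
    rfl

theorem dim_charT_le {n : ℕ} (e : S.CellT F n) (x : Q n) : (charT e x).dim ≤ n := by
  rcases charT_cases e x with ⟨-, h⟩ | ⟨h, e⟩
  · exact h.le
  · rw [e]

theorem Space.eq_charT (p : S.Space F) :
    p = charT p.cell ⟨p.pos, mem_closedBall_zero_iff.2 p.norm_lt.le⟩ := by
  rcases charT_cases p.cell ⟨p.pos, mem_closedBall_zero_iff.2 p.norm_lt.le⟩ with ⟨h, -⟩ | ⟨_, h⟩
  · exact absurd h p.norm_lt.ne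
  · exact h.symm

/-- The finest topology for which the characteristic maps are continuous. -/
noncomputable instance : TopologicalSpace (S.Space F) :=
  ⨆ (n : ℕ) (e : S.CellT F n), TopologicalSpace.coinduced (charT e) inferInstance

theorem isClosed_space {A : Set (S.Space F)} :
    IsClosed A ↔ ∀ n, ∀ e : S.CellT F n, IsClosed (charT e ⁻¹' A) := by
  refine isClosed_iSup_iff.trans (forall_congr' fun n => ?_)
  refine isClosed_iSup_iff.trans (forall_congr' fun e => ?_)
  exact isClosed_coinduced

theorem continuous_charT {n : ℕ} (e : S.CellT F n) : Continuous (charT e) :=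
  continuous_iff_isClosed.2 fun _ hA => isClosed_space.1 hA n e

theorem continuous_of_charT {Y : Type*} [TopologicalSpace Y] {f : S.Space F → Y}
    (h : ∀ n, ∀ e : S.CellT F n, Continuous fun x => f (charT e x)) : Continuous f :=
  continuous_iff_isClosed.2 fun _ hA => isClosed_space.2 fun n e => hA.preimage (h n e)

theorem continuous_push (k : ℕ) (t : T) : Continuous fun p : S.St k => Pt.push F t p :=
  continuous_iff_isClosed.2 fun A hA => isClosed_St.2 fun n _ e => by
    have := isClosed_space.1 hA n (e.1, e.2.1, F.left e.2.2 t)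
    convert this using 1
    ext x
    exact iff_of_eq (congrArg (· ∈ A) (push_char t e x))

instance : ContinuousConstSMul N (S.Space F) where
  continuous_const_smul a := continuous_of_charT fun n e => by
    simp only [smul_charT]
    exact continuous_charT _

/-- A set whose preimages in the cells of dimension less than `k` are closed has a closed preimage
in the boundary of a `k`-cell, because the attaching map is continuous. -/
theorem isClosed_sphere {k : ℕ} {A : Set (S.Space F)}
    (h : ∀ j < k, ∀ e : S.CellT F j, IsClosed (charT e ⁻¹' A)) (e : S.CellT F k) :
    IsClosed {x : Q k | ‖x.1‖ = 1 ∧ charT e x ∈ A} := by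
  have h₁ : IsClosed {p : S.St k | Pt.push F e.2.2 p ∈ A} := by
    refine isClosed_St.2 fun j hj f => ?_
    convert h j hj (f.1, f.2.1, F.left f.2.2 e.2.2) using 1
    ext x
    exact iff_of_eq (congrArg (· ∈ A) (push_char e.2.2 f x))
  have h₂ : IsClosed {x : Sph k |
      charT e ⟨x.1, Metric.sphere_subset_closedBall x.2⟩ ∈ A} :=
    h₁.preimage ((continuous_tr e.1 1).comp ((att_and_hCont k).1 e.2.1))
  have hemb : Topology.IsClosedEmbedding
      (fun x : Sph k => (⟨x.1, Metric.sphere_subset_closedBall x.2⟩ : Q k)) :=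
    ((continuous_subtype_val.subtype_mk _).isClosedEmbedding fun a b h =>
      Subtype.ext (congrArg (fun x : Q k => x.1) h))
  convert hemb.isClosedMap _ h₂ using 1
  ext x
  constructor
  · rintro ⟨hx, hx'⟩
    exact ⟨⟨x.1, mem_sphere_zero_iff_norm.2 hx⟩, hx', rfl⟩
  · rintro ⟨y, hy, rfl⟩
    exact ⟨norm_of_Sph y, hy⟩

/-- A homeomorphism from the Euclidean unit ball to the cube that maps the sphere to the boundary.
-/
noncomputable def ballEquiv (n : ℕ) : MonoidTopology.Ball n ≃ₜ Q n :=
  (exists_homeomorph_ball_cube n).choose.subtype fun x => by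
    rw [mem_closedBall_zero_iff, mem_closedBall_zero_iff]
    exact ((exists_homeomorph_ball_cube n).choose_spec x).2

theorem norm_ballEquiv_lt {n : ℕ} (b : MonoidTopology.Ball n) :
    ‖(ballEquiv n b).1‖ < 1 ↔ ‖(b : EuclideanSpace ℝ (Fin n))‖ < 1 :=
  ((exists_homeomorph_ball_cube n).choose_spec b.1).1.symm

theorem norm_ballEquiv_eq {n : ℕ} (b : MonoidTopology.Ball n) :
    ‖(ballEquiv n b).1‖ = 1 ↔ ‖(b : EuclideanSpace ℝ (Fin n))‖ = 1 := by
  have h₁ := norm_le_of_Q (ballEquiv n b)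
  have h₂ : ‖(b : EuclideanSpace ℝ (Fin n))‖ ≤ 1 := mem_closedBall_zero_iff.1 b.2
  rw [← h₁.not_lt_iff_eq, ← h₂.not_lt_iff_eq, norm_ballEquiv_lt]

variable (S F)

/-- The cell structure of the classifying space. -/
noncomputable def projectiveCW : MonoidTopology.ProjectiveCW N (S.Space F) where
  cell n := S.CellT F n
  cellAction n := inferInstance
  projective n := cellT_projective n
  skelLT n := {p | p.dim < n}
  skelLT_zero := by
    ext p
    simp
  charMap n e :=
    ⟨fun b => charT e (ballEquiv n b), (continuous_charT e).comp (ballEquiv n).continuous⟩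
  charMap_smul n a e b := (smul_charT a e _).symm
  charMap_sphere n e b hb := by
    rcases charT_cases e (ballEquiv n b) with ⟨-, h⟩ | ⟨h, -⟩
    · exact h
    · exact absurd ((norm_ballEquiv_eq b).2 hb) h.ne
  skelLT_succ n := by
    ext p
    constructor
    · intro hp
      rcases (Nat.lt_succ_iff.1 hp).lt_or_eq with h | h
      · exact Or.inl h
      · obtain ⟨k, e, x, hx⟩ := p
        obtain rfl : k = n := h
        refine Or.inr ⟨e, (ballEquiv k).symm ⟨x, mem_closedBall_zero_iff.2 hx.le⟩, ?_⟩
        refine Eq.trans ?_ (Space.eq_charT ⟨k, e, x, hx⟩).symm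
        exact congrArg (charT e) ((ballEquiv k).apply_symm_apply _)
    · rintro (h | ⟨e, b, rfl⟩)
      · exact Nat.lt_succ_of_lt h
      · exact Nat.lt_succ_of_le (dim_charT_le e _)
  charMap_notMem n e b hb := by
    rcases charT_cases e (ballEquiv n b) with ⟨h, -⟩ | ⟨_, h⟩
    · exact absurd h ((norm_ballEquiv_lt b).2 hb).ne
    · intro h'
      change (charT e (ballEquiv n b)).dim < n at h'
      rw [h] at h'
      exact lt_irrefl _ h'
  charMap_inj n e e' b b' hb hb' h := by
    change charT e (ballEquiv n b) = charT e' (ballEquiv n b') at h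
    rcases charT_cases e (ballEquiv n b) with ⟨h₁, -⟩ | ⟨_, h₁⟩
    · exact absurd h₁ ((norm_ballEquiv_lt b).2 hb).ne
    rcases charT_cases e' (ballEquiv n b') with ⟨h₂, -⟩ | ⟨_, h₂⟩
    · exact absurd h₂ ((norm_ballEquiv_lt b').2 hb').ne
    rw [h₁, h₂] at h
    obtain ⟨-, h₃, h₄⟩ := Space.mk.inj h
    exact ⟨eq_of_heq h₃, (ballEquiv n).injective (Subtype.ext (eq_of_heq h₄))⟩
  isClosed_of_skelLT_succ n A hA hA' hcl := by
    have hcl' : ∀ e : S.CellT F n, IsClosed (charT e ⁻¹' A) := fun e => by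
      have := (hcl e).preimage (ballEquiv n).symm.continuous
      convert this using 1
      ext x
      change charT e x ∈ A ↔ charT e (ballEquiv n ((ballEquiv n).symm x)) ∈ A
      rw [(ballEquiv n).apply_symm_apply]
    -- A cell of dimension `k > n` meets `A` only in its boundary, whose image lies in lower cells.
    refine isClosed_space.2 fun k => ?_
    induction k using Nat.strong_induction_on with
    | _ k ih =>
      intro e
      rcases lt_trichotomy k n with hk | rfl | hk
      · convert isClosed_space.1 hA' k e using 1
        ext x
        exact ⟨fun h => ⟨h, (dim_charT_le e x).trans_lt hk⟩, fun h => h.1⟩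
      · exact hcl' e
      · convert isClosed_sphere ih e using 1
        ext x
        refine ⟨fun h => ?_, fun h => h.2⟩
        rcases charT_cases e x with ⟨h', -⟩ | ⟨_, h'⟩
        · exact ⟨h', h⟩
        · have h₁ : (charT e x).dim < n + 1 := hA h
          rw [h'] at h₁
          exact absurd h₁ (by simpa using hk)
  iUnion_skelLT := Set.eq_univ_of_forall fun p =>
    Set.mem_iUnion.2 ⟨p.dim + 1, Nat.lt_succ_self p.dim⟩
  isClosed_of_skelLT A hA := isClosed_space.2 fun n e => by
    convert isClosed_space.1 (hA (n + 1)) n e using 1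
    ext x
    exact ⟨fun h => ⟨h, Nat.lt_succ_of_le (dim_charT_le e x)⟩, fun h => h.1⟩

theorem projectiveCW_finiteType : (S.projectiveCW F).FiniteType := fun n => cellT_fg n

variable {S F}

/-! ### The components of the classifying space -/

/-- The contraction of the classifying space, which pushes forward the contraction of the points
`S.Pt`. -/
noncomputable def contraction (τ : I) (p : S.Space F) : S.Space F :=
  Pt.push F p.cell.2.2
    (S.h (p.dim + 1) τ ⟨p.dim, (p.cell.1, p.cell.2.1, 1), p.pos, p.norm_lt⟩)

/-- The element of `T` that belongs to the component of a point. -/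
def Space.val (p : S.Space F) : T := F.left (p.cell.1 * S.val p.cell.2.1) p.cell.2.2

/-- The critical point that represents an element of `T`. -/
def critT (t : T) : S.Space F := (S.crit 1).push F t

theorem val_push (t : T) (p : S.Pt) : (p.push F t).val = F.left p.val t := by
  simp [Space.val, Pt.push, Pt.val, F.left_mul]

theorem h_of_dim_lt {n : ℕ} {p : S.Pt} (h : p.dim < n) (τ : ℝ) :
    S.h n τ p = S.h (p.dim + 1) τ p := by
  induction n, Nat.succ_le_of_lt h using Nat.le_induction with
  | base => rfl
  | succ n hn ih => rw [h_succ_of_mem (Or.inl hn), ih hn]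

theorem contraction_push (τ : I) (t : T) (p : S.Pt) :
    contraction τ (p.push F t) = (S.h (p.dim + 1) τ p).push F t := by
  obtain ⟨k, ⟨m, c, m'⟩, x, hx⟩ := p
  have h := ((good (k + 1)).2 (⟨k, (m, c, 1), x, hx⟩ : S.Pt) (Or.inl (Nat.lt_succ_self k))
    τ τ.2.1 τ.2.2).2.2.2 m'
  have e : (⟨k, (m, c, m'), x, hx⟩ : S.Pt) = Pt.tr 1 m' ⟨k, (m, c, 1), x, hx⟩ := by
    simp [Pt.tr]
  have h' : S.h (k + 1) τ ⟨k, (m, c, m'), x, hx⟩ =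
      Pt.tr 1 m' (S.h (k + 1) τ ⟨k, (m, c, 1), x, hx⟩) := e ▸ h
  exact ((congrArg (Pt.push F t) h').trans (Pt.push_tr t m' _)).symm

theorem contraction_charT {n : ℕ} (τ : I) (e : S.CellT F n) (x : Q n) :
    contraction τ (charT e x) = (S.h (n + 1) τ (S.char (e.1, e.2.1, 1) x)).push F e.2.2 := by
  rw [charT, contraction_push, h_of_dim_lt (Nat.lt_succ_of_le (dim_char_le _ x))]

theorem continuous_contraction : Continuous fun p : I × S.Space F => contraction p.1 p.2 := by
  have hcell : ∀ n, ∀ e : S.CellT F n,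
      Continuous fun p : I × Q n => contraction p.1 (charT e p.2) := fun n e => by
    simp only [contraction_charT]
    exact (continuous_push (n + 2) e.2.2).comp
      ((att_and_hCont (n + 1)).2.1 n (Nat.lt_succ_self n) (e.1, e.2.1, 1))
  have hpt : ∀ p : S.Space F, Continuous fun τ => contraction τ p := fun p => by
    rw [Space.eq_charT p]
    exact (hcell _ p.cell).comp (by fun_prop : Continuous fun τ : I => (τ, _))
  let G : S.Space F → C(I, S.Space F) := fun p => ⟨fun τ => contraction τ p, hpt p⟩
  have hG : Continuous G := continuous_of_charT fun n e =>
    ContinuousMap.continuous_of_continuous_uncurry _ ((hcell n e).comp continuous_swap)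
  exact continuous_of_continuous_curry hG continuous_id

theorem Space.exists_push (p : S.Space F) : ∃ (t : T) (q : S.Pt), p = q.push F t :=
  ⟨p.cell.2.2, ⟨p.dim, (p.cell.1, p.cell.2.1, 1), p.pos, p.norm_lt⟩, by
    simp [Pt.push, F.left_one]; rfl⟩

theorem contraction_zero (p : S.Space F) : contraction 0 p = p := by
  obtain ⟨t, q, rfl⟩ := p.exists_push
  rw [contraction_push]
  exact congrArg (Pt.push F t) (h_zero _ q)

theorem contraction_one (p : S.Space F) : contraction 1 p = critT p.val := by
  obtain ⟨t, q, rfl⟩ := p.exists_push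
  have h := ((good (q.dim + 1)).2 q (Or.inl (Nat.lt_succ_self _)) 1 zero_le_one le_rfl).2.2.1
  rw [contraction_push, val_push]
  refine (congrArg (Pt.push F t) h).trans ?_
  simp [critT, Pt.push, crit, F.left_one]

theorem val_contraction (τ : I) (p : S.Space F) : (contraction τ p).val = p.val := by
  obtain ⟨t, q, rfl⟩ := p.exists_push
  have h := ((good (q.dim + 1)).2 q (Or.inl (Nat.lt_succ_self _)) τ τ.2.1 τ.2.2).2.1
  rw [contraction_push, val_push, val_push, Pt.val_eq_of_ptLE h]
  rfl

theorem val_critT (t : T) : (critT t : S.Space F).val = t := by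
  rw [critT, val_push, val_crit, F.left_one]

theorem val_smul (a : N) (p : S.Space F) :
    (a • p).val = F.left (F.proj a) (F.right a p.val) := by
  change F.left (F.proj a * p.cell.1 * S.val p.cell.2.1) (F.right a p.cell.2.2) = _
  rw [Space.val, F.comm, mul_assoc, F.left_mul]

theorem val_charT {n : ℕ} (e : S.CellT F n) (x : Q n) :
    (charT e x).val = F.left (e.1 * S.val e.2.1) e.2.2 := by
  have h := Pt.val_eq_of_ptLE (((good n).1 e.2.1 x (norm_le_of_Q x)).1.tr e.1 1)
  rw [charT, val_push]
  exact congrArg (F.left · e.2.2) (h.trans (mul_one _))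

/-- The map `Space.val` is constant on cells, hence continuous for the discrete topology. -/
theorem val_eq_of_joined {p q : S.Space F} (h : Joined p q) : p.val = q.val := by
  let _ : TopologicalSpace T := ⊥
  have : DiscreteTopology T := ⟨rfl⟩
  have hval : Continuous (Space.val : S.Space F → T) := continuous_of_charT fun n e => by
    simp only [val_charT]
    exact continuous_const
  have hc : Continuous fun τ => (h.somePath τ).val := hval.comp h.somePath.continuous
  have := (IsLocallyConstant.iff_continuous _).2 hc |>.apply_eq_of_isPreconnected
    isPreconnected_univ (Set.mem_univ (0 : I)) (Set.mem_univ (1 : I))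
  simpa using this

theorem joined_critT (p : S.Space F) : Joined p (critT p.val) :=
  ⟨{ toFun := fun τ => contraction τ p
     continuous_toFun := continuous_contraction.comp (by fun_prop : Continuous fun τ : I => (τ, p))
     source' := contraction_zero p
     target' := contraction_one p }⟩

theorem joined_iff {p q : S.Space F} : Joined p q ↔ p.val = q.val :=
  ⟨val_eq_of_joined, fun h => (joined_critT p).trans (h ▸ (joined_critT q).symm)⟩

theorem contractibleSpace_fiber (t : T) : ContractibleSpace {p : S.Space F | p.val = t} := by
  rw [contractible_iff_id_nullhomotopic]
  refine ⟨⟨critT t, val_critT t⟩, ⟨{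
    toFun := fun p => ⟨contraction p.1 p.2.1, (val_contraction _ _).trans p.2.2⟩
    continuous_toFun := (continuous_contraction.comp (by fun_prop :
      Continuous fun p : I × {p : S.Space F | p.val = t} => (p.1, p.2.1))).subtype_mk _
    map_zero_left := fun p => Subtype.ext (contraction_zero _)
    map_one_left := fun p => Subtype.ext ((contraction_one _).trans (congrArg critT p.2)) }⟩⟩

theorem contractibleSpace_pathComponent (p : S.Space F) :
    ContractibleSpace (pathComponent p) := by
  have h : pathComponent p = {q : S.Space F | q.val = p.val} := by
    ext q
    exact joined_iff.trans eq_comm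
  rw [h]
  exact contractibleSpace_fiber _

variable (S F)

/-- The path components of the classifying space correspond to the elements of `T`. -/
noncomputable def zerothHomotopyEquiv : ZerothHomotopy (S.Space F) ≃ T where
  toFun := Quotient.lift Space.val fun _ _ h => val_eq_of_joined h
  invFun t := ZerothHomotopy.mk (critT t)
  left_inv := by
    rintro ⟨p⟩
    exact Quotient.sound (joined_critT p).symm
  right_inv t := val_critT t

end CollapsingScheme

namespace CollapsingScheme

variable {M : Type u} [Monoid M]

theorem leftFInfty (S : CollapsingScheme M) : MonoidTopology.LeftFInfty M := by
  refine ⟨S.Space (Frame.one M), inferInstance, inferInstance, inferInstance,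
    S.projectiveCW (Frame.one M), ?_, S.projectiveCW_finiteType _⟩
  have := contractibleSpace_fiber (S := S) (F := Frame.one M) ⟨⟩
  have h : {p : S.Space (Frame.one M) | p.val = ⟨⟩} = Set.univ :=
    Set.eq_univ_of_forall fun p => rfl
  rw [h] at this
  exact (Homeomorph.Set.univ _).contractibleSpace_iff.1 this

theorem biFInfty (S : CollapsingScheme M) : MonoidTopology.BiFInfty M := by
  refine ⟨S.Space (Frame.bi M), inferInstance, inferInstance, inferInstance,
    S.projectiveCW (Frame.bi M), ⟨S.zerothHomotopyEquiv (Frame.bi M), ?_⟩,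
    contractibleSpace_pathComponent, S.projectiveCW_finiteType _⟩
  rintro a ⟨p⟩
  exact (val_smul a p).trans (mul_assoc _ _ _).symm

end CollapsingScheme

theorem mainTheorem1 {M : Type u} [Monoid M] {A : Type v} [Finite A]
    (R : Set (FreeMonoid A × FreeMonoid A)) (hfin : R.Finite)
    (hcomplete : StringRewriting.Complete R) (hpres : StringRewriting.Presents R M) :
    (MonoidTopology.LeftFInfty M ∧ MonoidTopology.RightFInfty M ∧ MonoidTopology.BiFInfty M) ∧
      MonoidTopology.BiFPInfty M ∧
      (MonoidTopology.LeftFPInfty M ∧ MonoidTopology.RightFPInfty M) := by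
  obtain ⟨N⟩ := hcomplete.nonempty_normalForms hfin hpres
  let S := N.collapsingScheme
  let S' := N.op.collapsingScheme
  exact ⟨⟨S.leftFInfty, S'.leftFInfty, S.biFInfty⟩, S.biFPInfty, S.leftFPInfty, S'.leftFPInfty⟩
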